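/- **Setting.** Let $d\ge 1$ and let $\Lambda_L(x)=\{y\in\mathbb R^d:\ |y_i-x_i|<L/2 \text{ for all } i\}$. Let $u:\mathbb R^d\to\mathbb R$ be measurable with $u_-\chi_{\Lambda_{\delta_-}(0)}\le u\le u_+\chi_{\Lambda_{\delta_+}(0)}$ a.e., where $u_\pm,\delta_\pm>0$. Let $0<\varepsilon<1$, $\beta(1-\varepsilon)>\frac43$, $\beta>1$, $L_1>1$, $L_{j+1}=L_j^{\beta}$, $\alpha_0=1$, $\alpha_j=e^{-L_j}$ $(j\ge1)$, and assume $2\alpha_{j+1}<\alpha_j$ for all $j\ge 0$. Starting from $\mathcal K^{(0)}=[0,1]$, each of the $2^j$ intervals of $\mathcal K^{(j)}$, of length $\alpha_j$, is replaced in $\mathcal K^{(j+1)}$ by the two intervals of length $\alpha_{j+1}$ at its edges. Let $\mathcal K=\bigcap_j\mathcal K^{(j)}$, and let $\mu$ be the uniform measure on $\mathcal K$ (every interval of $\mathcal K^{(j)}$ has mass $2^{-j}$); let $\Omega=\mathcal K^{\mathbb Z^d}$ with $\mathbb P=\mu^{\otimes\mathbb Z^d}$. For a finite $A\subset\mathbb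 Z^d$ let $C^{(j)}_A\cong\{1,\dots,2^j\}^A$, with the product order, be the set of families $[A]$ of intervals of $\mathcal K^{(j)}$ indexed by $A$, the intervals being numbered from left to right. For a box $\Lambda=\Lambda_L(x)$ the resolution of $L$ is the integer $k\ge 1$ with $L_{k-1}<L^{1-\varepsilon}\le L_k$. Let $S\subset\Lambda_{L-\delta_+}(x)\cap\mathbb Z^d$ (the free sites), $B=(\Lambda\cap\mathbb Z^d)\setminus S$ and $[B]\in C^{(k)}_B$. The basic event $\mathcal C=\mathcal C_{\Lambda,[B],S}$ is the set of the $\omega\in\Omega$ with $\omega_i\in[B]_i$ for all $i\in B$; for $[S]\in C^{(j)}_S$ let $([B],[S])$ be the set of the $\omega\in\mathcal C$ with $\omega_i\in[S]_i$ for all $i\in S$. For a real configuration $\eta$ and $t_S\in[0,1]^S$ let $H_{\eta,t_S,\Lambda}=-\Delta_\Lambda+\sum_{\zeta\in B}\eta_\zeta u(\cdot-\zeta)+\sum_{\zeta\in S}t_\zeta u(\cdot-\zeta)$ on $L^2(\Lambda)$, with Dirichlet boundary condition. **Lemma.** Let in addition $0<\delta<d$ and $c_1,c_2,c_3>0$.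 There are constants $C>0$ and $L_{\min}$ such that the following holds for all $L\ge L_{\min}$, with $k$ the resolution of $L$ and $\ell=L^{1/\beta}$, and for all $x$, $S$, $[B]$ as above with $|S|\ge\ell^{d-\delta}$, all $E_0\in\mathbb R$ and all $\omega\in\mathcal C$. Put $$I=(E_0-e^{-c_1\ell},E_0+e^{-c_1\ell}),\qquad W=(E_0-e^{-2c_3\ell^{4/3}\log\ell},E_0+e^{-2c_3\ell^{4/3}\log\ell}).$$ Let $\mathcal Q\ni\omega$ be a convex set of real configurations $\eta$ with $\eta_i\in[B]_i$ for all $i\in B$ (for example $\mathcal Q=\{\omega\}$, or the set of all such $\eta$). Let $E_\tau(\eta,t_S)$, $\tau=0,1,2,\dots$, be continuous functions of $(\eta,t_S)\in\mathcal Q\times[0,1]^S$ which for all $(\eta,t_S)$ are the eigenvalues of $H_{\eta,t_S,\Lambda}$, repeated according to multiplicity, and let $\tau_0$ be such that $E_{\tau_0}(\omega,0)\in I$. Suppose that, for all $t_S\in[0,1]^S$ with $E_{\tau_0}(\omega,t_S)\in I$ and all $i\in S$, the partial derivative of $E_{\tau_0}(\omega,\cdot)$ exists and $$e^{-c_3\ell^{4/3}\log\ell}\le\frac{\partial}{\partial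 t_i}E_{\tau_0}(\omega,t_S)\le e^{-c_2\ell}.$$ Then there is a finite disjoint union $\Omega_{[B]}=\bigsqcup_l([B],[S]_l)\subset\mathcal C$, with $[S]_l\in C^{(k)}_S$, such that: 1. $\{\omega'\in\mathcal C:\ E_{\tau_0}(\omega,\omega'_S)\in W\}\subset\mathcal C\setminus\Omega_{[B]}$ and $\{\omega'\in\mathcal C\cap\mathcal Q:\ E_{\tau_0}(\omega',\omega'_S)\in W\}\subset\mathcal C\setminus\Omega_{[B]}$; 2. $\mathcal C\setminus\Omega_{[B]}=\bigcup_{a\in\mathcal A}([B],a)$ for some antichain $\mathcal A\subset C^{(j)}_S$, where $j\in\{k-1,k\}$, and $j=k$ if $L_{k-1}\le\frac{c_3}2\ell^{4/3}\log\ell$; 3. $\mathbb P(\mathcal C\setminus\Omega_{[B]}\mid\mathcal C)\le C\,\ell^{-\frac d2+\frac\delta2}$. -/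

import Mathlib

open MeasureTheory ProbabilityTheory Filter Topology Set
open scoped ENNReal

noncomputable section

namespace CantorAnderson

/-! ## The Cantor set and its uniform measure -/

/-- The scales `L_k = L₁ ^ (β ^ (k - 1))`, i.e. `L_{k+1} = L_k ^ β` with initial scale `L₁`. -/
def scale (β L₁ : ℝ) (k : ℕ) : ℝ := L₁ ^ (β ^ ((k : ℝ) - 1))

/-- The length `α_k` of the intervals of generation `k`: `α_0 = 1` and `α_k = exp (-L_k)`. -/
def len (β L₁ : ℝ) (k : ℕ) : ℝ := if k = 0 then 1 else Real.exp (-scale β L₁ k)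

/-- Parameters for which the Cantor set can be constructed: two disjoint intervals of
length `α_{k+1}` have to fit, with a gap between them, in an interval of length `α_k`. -/
structure CantorParams where
  β : ℝ
  L₁ : ℝ
  one_lt_β : 1 < β
  one_lt_L₁ : 1 < L₁
  gap : ∀ k : ℕ, 2 * len β L₁ (k + 1) < len β L₁ k

namespace CantorParams

variable (p : CantorParams)

/-- The left end of the `n`-th interval (`0 ≤ n < 2 ^ k`, counted from the left) of
generation `k`. An interval of generation `k` with number `n` keeps at its edges the
intervals of generation `k + 1` with numbers `2 n` and `2 n + 1`. -/
def left : ℕ → ℕ → ℝ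
  | 0, _ => 0
  | k + 1, n => left k (n / 2) +
      if n % 2 = 1 then len p.β p.L₁ k - len p.β p.L₁ (k + 1) else 0

/-- The `n`-th interval of generation `k`. -/
def interval (k n : ℕ) : Set ℝ := Icc (p.left k n) (p.left k n + len p.β p.L₁ k)

/-- The union `𝒦^(k)` of the intervals of generation `k`. -/
def generation (k : ℕ) : Set ℝ := ⋃ n : Fin (2 ^ k), p.interval k n

/-- The Cantor set `𝒦`. -/
def cantor : Set ℝ := ⋂ k : ℕ, p.generation k

/-- The point of the Cantor set with address `s`: at generation `k + 1` one goes
to the right interval if `s k` is true and to the left one otherwise. -/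
def point (s : ℕ → Bool) : ℝ :=
  ∑' k : ℕ, if s k then len p.β p.L₁ k - len p.β p.L₁ (k + 1) else 0

/-- The uniform measure on the Cantor set: the law of the point whose address is a
sequence of independent fair coin tosses. -/
def cantorMeasure : Measure ℝ :=
  (Measure.infinitePi fun _ : ℕ => (PMF.uniformOfFintype Bool).toMeasure).map p.point

lemma len_pos (k : ℕ) : 0 < len p.β p.L₁ k := by
  unfold len; split_ifs <;> positivity

lemma gap_pos (k : ℕ) : 0 < len p.β p.L₁ k - len p.β p.L₁ (k + 1) := by
  have := p.gap k; have := p.len_pos (k + 1); linarith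

lemma summable_gaps : Summable fun k : ℕ => len p.β p.L₁ k - len p.β p.L₁ (k + 1) := by
  refine summable_of_sum_range_le (c := 1) (fun k => (p.gap_pos k).le) fun n => ?_
  rw [Finset.sum_range_sub']
  have := p.len_pos n
  simp only [len, if_true] at *
  linarith

lemma norm_digit_le (s : ℕ → Bool) (k : ℕ) :
    ‖if s k then len p.β p.L₁ k - len p.β p.L₁ (k + 1) else 0‖
      ≤ len p.β p.L₁ k - len p.β p.L₁ (k + 1) := by
  have := p.gap_pos k
  split_ifs
  · rw [Real.norm_of_nonneg this.le]
  · simpa using this.le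

lemma continuous_point : Continuous p.point := by
  refine continuous_tsum (fun k => ?_) p.summable_gaps fun k s => p.norm_digit_le s k
  exact (continuous_of_discreteTopology
    (f := fun b : Bool => if b then len p.β p.L₁ k - len p.β p.L₁ (k + 1) else 0)).comp
    (continuous_apply k)

instance : IsProbabilityMeasure p.cantorMeasure :=
  Measure.isProbabilityMeasure_map p.continuous_point.measurable.aemeasurable

end CantorParams

/-! ## Configurations, interval classes and basic events -/

/-- The lattice `ℤ^d`. -/
abbrev Zd (d : ℕ) := Fin d → ℤ

/-- The space `ℝ^d`. -/
abbrev Sp (d : ℕ) := EuclideanSpace ℝ (Fin d)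

/-- A lattice site as a point of `ℝ^d`. -/
def site {d : ℕ} (ζ : Zd d) : Sp d := WithLp.toLp 2 fun i => (ζ i : ℝ)

/-- The (open) box of side `L` centered at `x`. -/
def box {d : ℕ} (x : Sp d) (L : ℝ) : Set (Sp d) := {y | ∀ i, |y i - x i| < L / 2}

open Classical in
/-- The finite set of the lattice sites in the box of side `L` centered at `x`. -/
def boxSites {d : ℕ} (x : Sp d) (L : ℝ) : Finset (Zd d) :=
  (Fintype.piFinset fun i => Finset.Icc ⌊x i - L / 2⌋ ⌈x i + L / 2⌉).filter
    fun ζ => site ζ ∈ box x L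

lemma mem_boxSites {d : ℕ} {x : Sp d} {L : ℝ} {ζ : Zd d} :
    ζ ∈ boxSites x L ↔ site ζ ∈ box x L := by
  classical
  simp only [boxSites, Finset.mem_filter, Fintype.mem_piFinset, Finset.mem_Icc,
    and_iff_right_iff_imp]
  intro h i
  have hi := abs_lt.1 (h i)
  simp only [site] at hi
  constructor
  · have := Int.floor_le (x i - L / 2)
    exact_mod_cast (show ((⌊x i - L / 2⌋ : ℤ) : ℝ) ≤ (ζ i : ℝ) by linarith)
  · have := Int.le_ceil (x i + L / 2)
    exact_mod_cast (show (ζ i : ℝ) ≤ ((⌈x i + L / 2⌉ : ℤ) : ℝ) by linarith)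

/-- The set `Ω = 𝒦 ^ (ℤ^d)` of configurations. -/
def Omega (p : CantorParams) (d : ℕ) : Set (Zd d → ℝ) := {ω | ∀ ζ, ω ζ ∈ p.cantor}

/-- The law `ℙ` of the configuration: the product of copies of the Cantor measure. -/
def law (p : CantorParams) (d : ℕ) : Measure (Zd d → ℝ) :=
  Measure.infinitePi fun _ : Zd d => p.cantorMeasure

/-- The set `C_A^(k)` of the interval classes on the set `A` of sites at resolution `k`:
one of the `2 ^ k` intervals of generation `k`, numbered from the left, at every site.
It carries the product order. -/
abbrev Classes {d : ℕ} (k : ℕ) (A : Finset (Zd d)) := A → Fin (2 ^ k)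

/-- The values of `η` on `A` lie in the intervals of the class `a`. -/
def InClass {d : ℕ} (p : CantorParams) {k : ℕ} {A : Finset (Zd d)}
    (a : Classes k A) (η : Zd d → ℝ) : Prop :=
  ∀ i : A, η i ∈ p.interval k (a i)

/-- The basic event `𝒞_{Λ,[B],S}`, with `B` the fixed sites, `[B] = b`, at resolution `k`. The
free sites `S = (Λ ∩ ℤ^d) ∖ B` are unconstrained. -/
def bevent {d : ℕ} (p : CantorParams) {k : ℕ} {B : Finset (Zd d)} (b : Classes k B) :
    Set (Zd d → ℝ) :=
  {ω | ω ∈ Omega p d ∧ InClass p b ω}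

/-- The part `([B], [S])` of the basic event `𝒞_{Λ,[B],S}` where the configuration on the
free sites is in the class `[S] = s` (at a resolution `j` which need not be that of `[B]`). -/
def subevent {d : ℕ} (p : CantorParams) {k j : ℕ} {B S : Finset (Zd d)} (b : Classes k B)
    (s : Classes j S) : Set (Zd d → ℝ) :=
  {ω | ω ∈ bevent p b ∧ InClass p s ω}

/-- `k` is the resolution of the side `L`: `L ∈ ]L_{k-1}^(1+ε'), L_k^(1+ε')]`,
where `(1 + ε') (1 - ε) = 1`. -/
def IsResolution (p : CantorParams) (ε L : ℝ) (k : ℕ) : Prop :=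
  1 ≤ k ∧ scale p.β p.L₁ (k - 1) ^ (1 / (1 - ε)) < L ∧ L ≤ scale p.β p.L₁ k ^ (1 / (1 - ε))

/-! ## Finite volume operators -/

/-- Smooth functions with compact support in the open set `Λ`. -/
def IsTest {d : ℕ} (Λ : Set (Sp d)) (ψ : Sp d → ℂ) : Prop :=
  ContDiff ℝ (⊤ : ℕ∞) ψ ∧ HasCompactSupport ψ ∧ tsupport ψ ⊆ Λ

/-- The `i`-th partial derivative. -/
def partialDeriv {d : ℕ} (i : Fin d) (ψ : Sp d → ℂ) (y : Sp d) : ℂ :=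
  fderiv ℝ ψ y (EuclideanSpace.single i 1)

/-- The Hilbert space `L²(Λ)`. -/
abbrev L2 {d : ℕ} (Λ : Set (Sp d)) := Lp ℂ 2 (volume.restrict Λ)

/-- `φ` is in the Sobolev space `H¹₀(Λ)`, the closure of the test functions in the `H¹`-norm,
and `G` is its weak gradient. -/
def HasGradient₀ {d : ℕ} (Λ : Set (Sp d)) (φ : L2 Λ) (G : Fin d → L2 Λ) : Prop :=
  ∃ ψ : ℕ → Sp d → ℂ, (∀ n, IsTest Λ (ψ n)) ∧
    Tendsto (fun n => eLpNorm (fun y => ψ n y - φ y) 2 (volume.restrict Λ)) atTop (𝓝 0) ∧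
    ∀ i, Tendsto (fun n => eLpNorm (fun y => partialDeriv i (ψ n) y - G i y) 2
      (volume.restrict Λ)) atTop (𝓝 0)

/-- `φ` is in the domain of `-Δ_Λ + V` with Dirichlet boundary condition on `L²(Λ)` (`V` a
bounded potential) and `(-Δ_Λ + V) φ = f`: the operator associated with the closed
quadratic form `∫_Λ |∇φ|² + V |φ|²` on `H¹₀(Λ)`. -/
def SchrodingerEq {d : ℕ} (Λ : Set (Sp d)) (V : Sp d → ℝ) (φ f : L2 Λ) : Prop :=
  ∃ G : Fin d → L2 Λ, HasGradient₀ Λ φ G ∧ ∀ ψ : Sp d → ℂ, IsTest Λ ψ →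
    (∑ i, ∫ y in Λ, G i y * partialDeriv i ψ y) + ∫ y in Λ, (V y : ℂ) * φ y * ψ y
      = ∫ y in Λ, f y * ψ y

/-- The functions `E_τ`, `τ = 0, 1, 2, …`, are a continuous eigenvalue parametrization on `D` of
the spectra of the operators `-Δ_Λ + V_t`: they are continuous on `D`, and for every `t` in `D`
the `E_τ(t)` are the eigenvalues of the operator, repeated according to multiplicity, that is,
`L²(Λ)` has an orthonormal basis of eigenfunctions with these eigenvalues. -/
def IsEigenvalueParametrization {d : ℕ} (Λ : Set (Sp d)) {T : Type*} [TopologicalSpace T]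
    (D : Set T) (V : T → Sp d → ℝ) (E : ℕ → T → ℝ) : Prop :=
  (∀ τ, ContinuousOn (E τ) D) ∧
    ∀ t ∈ D, ∃ e : HilbertBasis ℕ ℂ (L2 Λ),
      ∀ τ, SchrodingerEq Λ (V t) (e τ) ((E τ t : ℂ) • e τ)

/-- The potential `∑_{ζ ∈ Λ ∩ ℤ^d} η_ζ u(y - ζ)` for the box `Λ` of side `L` centered at `x`. -/
def potential {d : ℕ} (u : Sp d → ℝ) (x : Sp d) (L : ℝ) (η : Zd d → ℝ) (y : Sp d) : ℝ :=
  ∑ ζ ∈ boxSites x L, η ζ * u (y - site ζ)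

open Classical in
/-- The configuration with the values `t_S` on `S` and `ω` off `S`. -/
def glue {d : ℕ} (S : Finset (Zd d)) (ω : Zd d → ℝ) (t : S → ℝ) (ζ : Zd d) : ℝ :=
  if h : ζ ∈ S then t ⟨ζ, h⟩ else ω ζ

/-- The restriction `ω_S` of `ω` to `S`. -/
def restr {d : ℕ} (S : Finset (Zd d)) (ω : Zd d → ℝ) (i : S) : ℝ := ω i

/-- Assumptions on the single-site potential: `u` is measurable and
`u₋ χ_{Λ_{δ₋}(0)} ≤ u ≤ u₊ χ_{Λ_{δ₊}(0)}` with positive constants. -/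
def IsSingleSite {d : ℕ} (u : Sp d → ℝ) (um up δm δp : ℝ) : Prop :=
  0 < um ∧ 0 < up ∧ 0 < δm ∧ 0 < δp ∧ AEStronglyMeasurable u volume ∧
    ∀ᵐ y, (box 0 δm).indicator (fun _ => um) y ≤ u y ∧
      u y ≤ (box 0 δp).indicator (fun _ => up) y

end CantorAnderson

end

open CantorAnderson

open MeasureTheory ProbabilityTheory Filter Topology Set
open scoped ENNReal

noncomputable section

/-! Freeze the background at `ω` and write `F(t) = E_{τ₀}(ω, t)`, `m` and `M` for the lower and
upper derivative bounds, `w = m²` for the half-width of `W`, and `N = (L + 3)^d`, which bounds the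
number of sites. Call a class touched if it contains a point with `|F - E₀| < w + κ`. Passing from a
touched class to a strictly larger one, some coordinate rises by at least a gap `γ` of the Cantor
set, and no coordinate falls by more than the interval length `α`. Hence `F` gains about `mγ` and
loses at most `2MαN`. If `mγ > 2(w + κ) + 2MαN`, then `F` is carried across the whole window, so the
two classes cannot both be touched: the touched classes form an antichain
(`isAntichain_touchedClasses`, by way of `le_of_partialDeriv_mem_Icc`). The derivative bounds hold
only while `F` is in `I`, so a barrier argument replaces the mean value theorem.

Cutting each chain of `2^(j+1)` intervals into pairs splits the product into Boolean cubes.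
Sperner's theorem in each cube bounds the proportion of the classes in an antichain by `1/√|S|`
(`card_antichain_le`, `choose_half_div_le`, `cond_iUnion_antichain_le`), and `|S| ≥ ℓ^(d-δ)`.

The margin `κ = N α_k u₊` covers the backgrounds in `Q` other than `ω`: along a segment of
potentials a continuous eigenvalue branch is Lipschitz (`abs_eigenvalue_sub_le_of_segment`). As the
branches are continuous but not ordered, this uses stability of the spectrum (`exists_abs_sub_le`),
its discreteness (a Rellich argument, `finite_of_orthonormal_of_gradient_le`) and continuous
induction.

It remains to find a generation for which the inequality holds (`exists_resolution`). Generation `k`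
works if `α_{k-1} ≥ 16m`; otherwise `α_{k-1}` is so small that the losses are negligible in
generation `k - 1`. -/

namespace CantorAnderson

/-! ### Antichains in products of chains, and central binomial coefficients -/

/-- The size of an antichain in a product of `n` chains with `2 ^ (j + 1)` elements. -/
lemma card_antichain_le {ι : Type*} [Fintype ι] [DecidableEq ι] {j : ℕ}
    (A : Finset (ι → Fin (2 ^ (j + 1)))) (hA : IsAntichain (· ≤ ·) (A : Set (ι → Fin (2 ^ (j + 1))))) :
    A.card ≤ (Fintype.card ι).choose (Fintype.card ι / 2) * (2 ^ j) ^ Fintype.card ι := by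
  -- Halving every coordinate cuts each chain into pairs `{2c, 2c + 1}`. The fibres are Boolean
  -- cubes, and there are `(2^j)^n` of them.
  have key := Finset.card_le_mul_card_image_of_maps_to (s := A)
    (t := Fintype.piFinset fun _ : ι => Finset.range (2 ^ j))
    (f := fun a i => (a i : ℕ) / 2) (n := (Fintype.card ι).choose (Fintype.card ι / 2)) ?_ ?_
  · simpa using key
  · intro a _
    simp only [Fintype.mem_piFinset, Finset.mem_range]
    intro i
    have h := (a i).2
    have h2 : 2 ^ (j + 1) = 2 * 2 ^ j := pow_succ' 2 j
    omega
  · intro c _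
    set F := A.filter fun a => (fun i => (a i : ℕ) / 2) = c with hF
    -- Within one fibre the order is inclusion of the sets of odd coordinates, so Sperner's theorem
    -- applies to the images.
    let g : (ι → Fin (2 ^ (j + 1))) → Finset ι := fun a => Finset.univ.filter fun i => (a i : ℕ) % 2 = 1
    have hg : ∀ a ∈ F, ∀ a' ∈ F, g a ⊆ g a' → a ≤ a' := by
      intro a ha a' ha' h i
      have h1 := congrFun (Finset.mem_filter.1 ha).2 i
      have h2 := congrFun (Finset.mem_filter.1 ha').2 i
      have h3 : (a i : ℕ) % 2 = 1 → (a' i : ℕ) % 2 = 1 := fun h0 => by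
        simpa [g] using h (by simpa [g] using h0 : i ∈ g a)
      rw [Fin.le_def]
      omega
    have hinj : Set.InjOn g F := fun a ha a' ha' h =>
      le_antisymm (hg a ha a' ha' h.le) (hg a' ha' a ha h.ge)
    rw [← Finset.card_image_of_injOn hinj]
    refine IsAntichain.sperner ?_
    intro s hs s' hs' hne hle
    simp only [Finset.coe_image, Set.mem_image, Finset.mem_coe] at hs hs'
    obtain ⟨a, ha, rfl⟩ := hs
    obtain ⟨a', ha', rfl⟩ := hs'
    refine hA (Finset.mem_filter.1 ha).1 (Finset.mem_filter.1 ha').1 ?_ (hg a ha a' ha' hle)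
    rintro rfl
    exact hne rfl

/-- The recursion `(m + 1) C_{m+1} = 2 (2m + 1) C_m` reduces the induction step to `(2m + 1)(2m + 3)
≤ (2m + 2)²`. -/
lemma centralBinom_sq_mul_le (m : ℕ) : m.centralBinom ^ 2 * (2 * m + 1) ≤ (4 ^ m) ^ 2 := by
  induction m with
  | zero => simp
  | succ m ih =>
    have h := Nat.succ_mul_centralBinom_succ m
    have h2 : (m + 1) ^ 2 * ((m + 1).centralBinom ^ 2 * (2 * (m + 1) + 1))
        ≤ (m + 1) ^ 2 * (4 ^ (m + 1)) ^ 2 := by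
      calc (m + 1) ^ 2 * ((m + 1).centralBinom ^ 2 * (2 * (m + 1) + 1))
          = ((m + 1) * (m + 1).centralBinom) ^ 2 * (2 * m + 3) := by ring
        _ = (m.centralBinom ^ 2 * (2 * m + 1)) * (4 * (2 * m + 1) * (2 * m + 3)) := by
          rw [h]; ring
        _ ≤ (4 ^ m) ^ 2 * (16 * (m + 1) ^ 2) := by
          refine Nat.mul_le_mul ih ?_
          nlinarith
        _ = (m + 1) ^ 2 * (4 ^ (m + 1)) ^ 2 := by ring
    exact Nat.le_of_mul_le_mul_left h2 (by positivity)

lemma choose_half_sq_mul_le (n : ℕ) : (n.choose (n / 2)) ^ 2 * n ≤ (2 ^ n) ^ 2 := by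
  obtain ⟨m, rfl | rfl⟩ := Nat.even_or_odd' n
  · have := centralBinom_sq_mul_le m
    rw [Nat.centralBinom_eq_two_mul_choose] at this
    rw [show 2 * m / 2 = m by omega, pow_mul, show 2 ^ 2 = 4 by norm_num]
    nlinarith [sq_nonneg ((2 * m).choose m)]
  -- For odd `n` the middle coefficient is half of the next central one, by Pascal's rule and
  -- symmetry.
  · have := centralBinom_sq_mul_le (m + 1)
    rw [Nat.centralBinom_eq_two_mul_choose, show 2 * (m + 1) = 2 * m + 1 + 1 by ring,
      Nat.choose_succ_succ, Nat.choose_symm_half] at this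
    rw [show (2 * m + 1) / 2 = m by omega, pow_succ 2, pow_mul, show 2 ^ 2 = 4 by norm_num]
    rw [pow_succ 4] at this
    nlinarith [sq_nonneg ((2 * m + 1).choose m)]

lemma choose_half_div_le (n : ℕ) (hn : 0 < n) :
    ((n.choose (n / 2) : ℕ) : ℝ) / 2 ^ n ≤ (Real.sqrt n)⁻¹ := by
  have h : ((n.choose (n / 2) : ℕ) : ℝ) ^ 2 * n ≤ (2 ^ n) ^ 2 := by
    exact_mod_cast choose_half_sq_mul_le n
  have hn' : (0 : ℝ) < n := by exact_mod_cast hn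
  rw [div_le_iff₀ (by positivity), inv_mul_eq_div, le_div_iff₀ (Real.sqrt_pos.2 hn')]
  refine abs_le_of_sq_le_sq' ?_ (by positivity) |>.2
  rwa [mul_pow, Real.sq_sqrt hn'.le]

/-! ### The intervals of the Cantor set and their masses -/

namespace CantorParams
variable (p : CantorParams)

lemma left_half_le_left (k n : ℕ) : p.left k (n / 2) ≤ p.left (k + 1) n := by
  have := p.gap_pos k
  rw [left]; split_ifs <;> linarith

lemma left_add_len_le (k n : ℕ) :
    p.left (k + 1) n + len p.β p.L₁ (k + 1) ≤ p.left k (n / 2) + len p.β p.L₁ k := by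
  have := p.gap_pos k
  rw [left]; split_ifs <;> linarith

lemma interval_succ_subset (k n : ℕ) : p.interval (k + 1) n ⊆ p.interval k (n / 2) :=
  Icc_subset_Icc (p.left_half_le_left k n) (p.left_add_len_le k n)

/-- A lower bound for the gaps between the intervals of one generation. -/
lemma left_add_len_add_le {c : ℝ} {k : ℕ}
    (hc : ∀ i < k, c ≤ len p.β p.L₁ i - 2 * len p.β p.L₁ (i + 1)) {n n' : ℕ} (h : n < n')
    (hn' : n' < 2 ^ k) : p.left k n + len p.β p.L₁ k + c ≤ p.left k n' := by
  induction k generalizing n n' with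
  | zero => simp at hn'; omega
  | succ k ih =>
    have h2 : 2 ^ (k + 1) = 2 * 2 ^ k := pow_succ' 2 k
    -- Intervals with different parents inherit the gap between the parents; siblings are separated
    -- by `α_k - 2 α_{k+1}`.
    rcases (Nat.div_le_div_right (c := 2) h.le).lt_or_eq with hlt | heq
    · have h1 := ih (fun i hi => hc i (by omega)) hlt (by omega)
      have h3 := p.left_half_le_left k n'
      have h4 := p.left_add_len_le k n
      linarith
    · have e1 : n % 2 = 0 := by omega
      have e2 : n' % 2 = 1 := by omega
      have := hc k (by omega)
      rw [left, left, heq]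
      simp only [e1, e2, if_true, zero_ne_one, if_false]
      linarith

lemma exists_pos_le_gap (k : ℕ) :
    ∃ c > 0, ∀ i < k, c ≤ len p.β p.L₁ i - 2 * len p.β p.L₁ (i + 1) := by
  induction k with
  | zero => exact ⟨1, one_pos, by simp⟩
  | succ k ih =>
    obtain ⟨c, hc0, hc⟩ := ih
    refine ⟨min c (len p.β p.L₁ k - 2 * len p.β p.L₁ (k + 1)),
      lt_min hc0 (by have := p.gap k; linarith), fun i hi => ?_⟩
    rcases Nat.lt_succ_iff_lt_or_eq.1 hi with h | rfl
    · exact (min_le_left _ _).trans (hc i h)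
    · exact min_le_right _ _

lemma left_add_len_lt {k n n' : ℕ} (h : n < n') (hn' : n' < 2 ^ k) :
    p.left k n + len p.β p.L₁ k < p.left k n' := by
  obtain ⟨c, hc0, hc⟩ := p.exists_pos_le_gap k
  have := p.left_add_len_add_le hc h hn'
  linarith

lemma interval_index_unique {k n n' : ℕ} (hn : n < 2 ^ k) (hn' : n' < 2 ^ k) {t : ℝ}
    (h : t ∈ p.interval k n) (h' : t ∈ p.interval k n') : n = n' := by
  by_contra hne
  rcases Nat.lt_or_gt_of_ne hne with hlt | hlt
  · have := p.left_add_len_lt hlt hn'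
    linarith [h.2, h'.1]
  · have := p.left_add_len_lt hlt hn
    linarith [h.1, h'.2]

lemma exists_mem_interval {t : ℝ} (ht : t ∈ p.cantor) (k : ℕ) :
    ∃ n : Fin (2 ^ k), t ∈ p.interval k n := by
  simpa [generation] using mem_iInter.1 ht k

lemma cantor_subset_Icc : p.cantor ⊆ Icc 0 1 := by
  intro t ht
  obtain ⟨n, hn⟩ := p.exists_mem_interval ht 0
  simpa [interval, left, len] using hn

lemma abs_sub_le_len {k n : ℕ} {s t : ℝ} (hs : s ∈ p.interval k n) (ht : t ∈ p.interval k n) :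
    |s - t| ≤ len p.β p.L₁ k := by
  rw [abs_le]
  constructor <;> linarith [hs.1, hs.2, ht.1, ht.2]

lemma measurableSet_interval (k n : ℕ) : MeasurableSet (p.interval k n) := measurableSet_Icc

lemma measurableSet_cantor : MeasurableSet p.cantor :=
  .iInter fun k => .iUnion fun n => p.measurableSet_interval k n

/-- The number of the interval of generation `k` containing the point with address `s`. -/
def code (s : ℕ → Bool) : ℕ → ℕ
  | 0 => 0
  | k + 1 => 2 * code s k + (s k).toNat

lemma code_lt (s : ℕ → Bool) (k : ℕ) : code s k < 2 ^ k := by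
  induction k with
  | zero => simp [code]
  | succ k ih =>
    have := Bool.toNat_le (s k)
    rw [code, pow_succ]; omega

lemma left_code (s : ℕ → Bool) (k : ℕ) : p.left k (code s k) =
    ∑ i ∈ Finset.range k, if s i then len p.β p.L₁ i - len p.β p.L₁ (i + 1) else 0 := by
  induction k with
  | zero => simp [left]
  | succ k ih =>
    rw [Finset.sum_range_succ, ← ih, left, code]
    cases s k
    · simp
    · rw [show (2 * code s k + true.toNat) / 2 = code s k by simp; omega]
      simp [Nat.add_mod]

/-- The first `k` digits sum to the left end of the interval, and the remaining ones are dominated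
by a telescoping sum of total at most `α_k`. -/
lemma point_mem_interval (s : ℕ → Bool) (k : ℕ) : p.point s ∈ p.interval k (code s k) := by
  have hs : Summable fun i : ℕ => if s i then len p.β p.L₁ i - len p.β p.L₁ (i + 1) else 0 :=
    .of_norm_bounded p.summable_gaps (p.norm_digit_le s)
  have h0 : ∀ i, 0 ≤ if s i then len p.β p.L₁ i - len p.β p.L₁ (i + 1) else 0 := fun i => by
    have := p.gap_pos i
    split_ifs <;> linarith
  have e := hs.sum_add_tsum_nat_add k
  rw [← left_code] at e
  have h1 : 0 ≤ ∑' i, if s (i + k) then len p.β p.L₁ (i + k) - len p.β p.L₁ (i + k + 1) else 0 :=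
    tsum_nonneg fun i => h0 _
  have h2 : ∑' i, (if s (i + k) then len p.β p.L₁ (i + k) - len p.β p.L₁ (i + k + 1) else 0)
      ≤ len p.β p.L₁ k := by
    refine Real.tsum_le_of_sum_range_le (fun i => h0 _) fun n => ?_
    calc ∑ i ∈ Finset.range n,
          (if s (i + k) then len p.β p.L₁ (i + k) - len p.β p.L₁ (i + k + 1) else 0)
        ≤ ∑ i ∈ Finset.range n, (len p.β p.L₁ (i + k) - len p.β p.L₁ (i + 1 + k)) := by
          refine Finset.sum_le_sum fun i _ => ?_
          have := p.gap_pos (i + k)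
          rw [show i + 1 + k = i + k + 1 by ring]
          split_ifs <;> linarith
      _ = len p.β p.L₁ (0 + k) - len p.β p.L₁ (n + k) :=
          Finset.sum_range_sub' (fun i => len p.β p.L₁ (i + k)) n
      _ ≤ len p.β p.L₁ k := by
          have := p.len_pos (n + k)
          rw [zero_add]; linarith
  have e' : p.point s = p.left k (code s k) +
      ∑' i, if s (i + k) then len p.β p.L₁ (i + k) - len p.β p.L₁ (i + k + 1) else 0 := e.symm
  rw [interval, mem_Icc, e']
  constructor <;> linarith

lemma point_mem_cantor (s : ℕ → Bool) : p.point s ∈ p.cantor :=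
  mem_iInter.2 fun k => mem_iUnion.2 ⟨⟨code s k, code_lt s k⟩, p.point_mem_interval s k⟩

/-- The number of an interval encodes exactly the first `k` digits, so the addresses leading to this
interval form a cylinder in the space of coin tosses. -/
lemma exists_code_eq_iff (k n : ℕ) (hn : n < 2 ^ k) :
    ∃ b : ℕ → Bool, ∀ s, code s k = n ↔ ∀ i ∈ Finset.range k, s i = b i := by
  induction k generalizing n with
  | zero => exact ⟨fun _ => false, fun s => by simp at hn; simp [code, hn]⟩
  | succ k ih =>
    obtain ⟨b, hb⟩ := ih (n / 2) (by rw [pow_succ] at hn; omega)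
    refine ⟨Function.update b k (decide (n % 2 = 1)), fun s => ?_⟩
    have h1 : (∀ i ∈ Finset.range (k + 1), s i = Function.update b k (decide (n % 2 = 1)) i) ↔
        s k = decide (n % 2 = 1) ∧ ∀ i ∈ Finset.range k, s i = b i := by
      rw [Finset.range_add_one, Finset.forall_mem_insert]
      refine and_congr (by simp) (forall₂_congr fun i hi => ?_)
      rw [Function.update_of_ne (Finset.mem_range.1 hi).ne]
    rw [h1, ← hb, code]
    rcases Nat.mod_two_eq_zero_or_one n with h | h <;> cases s k <;> simp [h] <;> omega

/-- Every interval of generation `k` has mass `2 ^ (-k)`. -/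
lemma cantorMeasure_interval {k n : ℕ} (hn : n < 2 ^ k) :
    p.cantorMeasure (p.interval k n) = (2⁻¹ : ℝ≥0∞) ^ k := by
  obtain ⟨b, hb⟩ := exists_code_eq_iff k n hn
  have e : p.point ⁻¹' p.interval k n = Set.pi (Finset.range k) fun i => {b i} := by
    ext s
    rw [Set.mem_pi]
    simp only [mem_preimage, Finset.mem_coe, mem_singleton_iff]
    rw [← hb]
    refine ⟨fun h => p.interval_index_unique (code_lt s k) hn (p.point_mem_interval s k) h, ?_⟩
    rintro rfl
    exact p.point_mem_interval s k
  rw [cantorMeasure, Measure.map_apply p.continuous_point.measurable (p.measurableSet_interval k n),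
    e, Measure.infinitePi_pi _ fun i _ => measurableSet_singleton _]
  rw [Finset.prod_congr rfl (g := fun _ => (2⁻¹ : ℝ≥0∞))]
  · simp
  · intro i _
    rw [PMF.toMeasure_apply_singleton _ _ (measurableSet_singleton _)]
    simp

lemma ae_mem_cantor : ∀ᵐ t ∂p.cantorMeasure, t ∈ p.cantor := by
  exact (ae_map_iff (p := (· ∈ p.cantor)) p.continuous_point.measurable.aemeasurable
    p.measurableSet_cantor).2 (.of_forall p.point_mem_cantor)

end CantorParams

/-! ### Probabilities of subevents and of antichains of classes -/

section Law
variable {d : ℕ} (p : CantorParams)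

instance : IsProbabilityMeasure (law p d) := by unfold law; infer_instance

lemma measurableSet_bevent {k : ℕ} {B : Finset (Zd d)} (b : Classes k B) :
    MeasurableSet (bevent p b) := by
  have : bevent p b = (⋂ ζ : Zd d, (fun ω => ω ζ) ⁻¹' p.cantor) ∩
      ⋂ i : B, (fun ω => ω i) ⁻¹' p.interval k (b i) := by
    ext ω; simp [bevent, Omega, InClass]
  rw [this]
  exact (MeasurableSet.iInter fun ζ => p.measurableSet_cantor.preimage (measurable_pi_apply ζ)).inter
    (.iInter fun i => (p.measurableSet_interval _ _).preimage (measurable_pi_apply _))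

lemma ae_mem_Omega : ∀ᵐ ω ∂law p d, ω ∈ Omega p d := by
  refine ae_all_iff.2 fun ζ => ?_
  have h := measurePreserving_eval_infinitePi (fun _ : Zd d => p.cantorMeasure) ζ
  exact h.quasiMeasurePreserving.ae p.ae_mem_cantor

/-- Almost every configuration lies in `Ω`, so up to a null set the event is a cylinder over the
disjoint sets `B` and `S`. -/
lemma law_subevent {k j : ℕ} {B S : Finset (Zd d)} (hBS : Disjoint B S) (b : Classes k B)
    (s : Classes j S) :
    law p d (subevent p b s) = ((2⁻¹ : ℝ≥0∞) ^ k) ^ B.card * ((2⁻¹ : ℝ≥0∞) ^ j) ^ S.card := by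
  classical
  let T : Zd d → Set ℝ := fun ζ => if h : ζ ∈ B then p.interval k (b ⟨ζ, h⟩) else
    if h : ζ ∈ S then p.interval j (s ⟨ζ, h⟩) else univ
  have hTB : ∀ i : B, T i = p.interval k (b i) := fun i => by simp [T]
  have hTS : ∀ i : S, T i = p.interval j (s i) := fun i => by
    have : (i : Zd d) ∉ B := fun h => Finset.disjoint_left.1 hBS h i.2
    simp [T, this]
  have e : subevent p b s =ᵐ[law p d] Set.pi ((B ∪ S : Finset (Zd d)) : Set (Zd d)) T := by
    filter_upwards [ae_mem_Omega p] with ω hω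
    apply propext
    change (ω ∈ bevent p b ∧ InClass p s ω) ↔ ω ∈ Set.pi _ T
    simp only [bevent, mem_ofPred_eq, hω, true_and, InClass, Set.mem_pi, Finset.mem_coe,
      Finset.mem_union]
    constructor
    · rintro ⟨h1, h2⟩ ζ (hζ | hζ)
      · rw [hTB ⟨ζ, hζ⟩]; exact h1 ⟨ζ, hζ⟩
      · rw [hTS ⟨ζ, hζ⟩]; exact h2 ⟨ζ, hζ⟩
    · intro h
      exact ⟨fun i => hTB i ▸ h i (Or.inl i.2), fun i => hTS i ▸ h i (Or.inr i.2)⟩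
  have hm : ∀ i ∈ B ∪ S, MeasurableSet (T i) := fun i _ => by
    simp only [T]; split_ifs <;> first | exact p.measurableSet_interval _ _ | exact .univ
  rw [measure_congr e, law, Measure.infinitePi_pi _ hm, Finset.prod_union hBS,
    Finset.prod_congr rfl (g := fun _ => (2⁻¹ : ℝ≥0∞) ^ k),
    Finset.prod_congr (s₁ := S) rfl (g := fun _ => (2⁻¹ : ℝ≥0∞) ^ j)]
  · simp
  · intro i hi
    rw [hTS ⟨i, hi⟩, p.cantorMeasure_interval (Fin.is_lt _)]
  · intro i hi
    rw [hTB ⟨i, hi⟩, p.cantorMeasure_interval (Fin.is_lt _)]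

lemma law_bevent {k : ℕ} {B : Finset (Zd d)} (b : Classes k B) :
    law p d (bevent p b) = ((2⁻¹ : ℝ≥0∞) ^ k) ^ B.card := by
  -- Without free sites the subevent is the basic event itself.
  have h := law_subevent p (Finset.disjoint_empty_right B) b (fun _ => 0 : Classes 0 ∅)
  have e : subevent p b (fun _ => 0 : Classes 0 (∅ : Finset (Zd d))) = bevent p b := by
    ext ω; simp [subevent, InClass]
  rw [e] at h
  simpa using h

lemma cond_iUnion_subevent_le {k j : ℕ} {B S : Finset (Zd d)} (hBS : Disjoint B S)
    (b : Classes k B) (A : Finset (Classes j S)) :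
    (cond (law p d) (bevent p b)).real (⋃ a ∈ A, subevent p b a)
      ≤ A.card / ((2 : ℝ) ^ j) ^ S.card := by
  have h1 : cond (law p d) (bevent p b) (⋃ a ∈ A, subevent p b a)
      ≤ A.card * ((2⁻¹ : ℝ≥0∞) ^ j) ^ S.card := by
    refine (measure_biUnion_finset_le A _).trans ?_
    have : ∀ a ∈ A, cond (law p d) (bevent p b) (subevent p b a)
        ≤ ((2⁻¹ : ℝ≥0∞) ^ j) ^ S.card := fun a _ => by
      rw [cond_apply (measurableSet_bevent p b)]
      rw [inter_eq_right.2 fun ω hω => hω.1, law_subevent p hBS, law_bevent, ← mul_assoc,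
        ENNReal.inv_mul_cancel, one_mul]
      · simp
      · simp
    calc _ ≤ ∑ a ∈ A, ((2⁻¹ : ℝ≥0∞) ^ j) ^ S.card := Finset.sum_le_sum this
      _ = _ := by simp
  have h2 := ENNReal.toReal_mono (by finiteness) h1
  rw [measureReal_def]
  refine h2.trans (le_of_eq ?_)
  simp [div_eq_mul_inv]

/-- The conditional probability of a union of subevents indexed by an antichain. -/
lemma cond_iUnion_antichain_le {k j : ℕ} (hj : 1 ≤ j) {B S : Finset (Zd d)} (hBS : Disjoint B S)
    (hS : 0 < S.card) (b : Classes k B) (A : Finset (Classes j S))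
    (hA : IsAntichain (· ≤ ·) (A : Set (Classes j S))) :
    (cond (law p d) (bevent p b)).real (⋃ a ∈ A, subevent p b a) ≤ (Real.sqrt S.card)⁻¹ := by
  classical
  -- The factor `(2^j)^|S|` counting the cubes cancels against the total number `(2^(j+1))^|S|` of
  -- classes, which leaves the middle binomial coefficient over `2^|S|`.
  obtain ⟨j, rfl⟩ := Nat.exists_eq_add_of_le' hj
  refine (cond_iUnion_subevent_le p hBS b A).trans (le_trans ?_ (choose_half_div_le _ hS))
  have h := card_antichain_le A hA
  rw [Fintype.card_coe] at h
  have h' : (A.card : ℝ) ≤ (S.card.choose (S.card / 2) : ℕ) * (2 ^ j) ^ S.card := by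
    exact_mod_cast h
  rw [div_le_div_iff₀ (by positivity) (by positivity)]
  calc (A.card : ℝ) * 2 ^ S.card
      ≤ (S.card.choose (S.card / 2) : ℕ) * (2 ^ j) ^ S.card * 2 ^ S.card := by gcongr
    _ = _ := by rw [pow_succ, mul_pow]; ring

end Law

/-! ### Monotonicity estimates under derivative bounds in a window -/

/-- A barrier argument: a function with slope more than `κ` wherever it has a value in an
interval `]A, B[` stays above a line of slope at most `κ` with values in `]A, B[`. -/
lemma le_of_deriv_lower_bound {g : ℝ → ℝ} {a b κ A B c v : ℝ} (hab : a ≤ b)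
    (hg : ContinuousOn g (Icc a b))
    (hd : ∀ x ∈ Ico a b, A < g x → g x < B → ∃ D, HasDerivWithinAt g D (Icc a b) x ∧ κ ≤ D)
    (hc : c ∈ Ioo A B) (hv : v ∈ Ioo A B) (hcv : a = b → v ≤ c) (hκ : a < b → v - c < κ * (b - a))
    (ha : c ≤ g a) : v ≤ g b := by
  rcases hab.eq_or_lt with rfl | hlt
  · exact (hcv rfl).trans ha
  set σ := (v - c) / (b - a) with hσ
  have hba : 0 < b - a := sub_pos.2 hlt
  have hσκ : σ < κ := by rw [hσ, div_lt_iff₀ hba]; exact hκ hlt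
  -- The barrier joins `(a, c)` to `(b, v)` and stays in the window, so the derivative bound is
  -- available wherever `g` meets it.
  let φ : ℝ → ℝ := fun x => c + σ * (x - a)
  have hφb : φ b = v := by simp only [φ, hσ]; field_simp; ring
  have hφc : Continuous φ := by fun_prop
  have hφI : ∀ x ∈ Icc a b, φ x ∈ Ioo A B := by
    intro x hx
    have e : φ x = ((b - x) / (b - a)) • c + ((x - a) / (b - a)) • v := by
      simp only [φ, hσ, smul_eq_mul]; field_simp; ring
    rw [e]
    refine (convex_Ioo A B) hc hv (div_nonneg (by linarith [hx.2]) hba.le)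
      (div_nonneg (by linarith [hx.1]) hba.le) ?_
    field_simp; ring
  have hsub : Icc a b ⊆ {x | φ x ≤ g x} := by
    refine IsClosed.Icc_subset_of_forall_exists_gt ?_ ?_ ?_
    · have : {x | φ x ≤ g x} ∩ Icc a b = {x ∈ Icc a b | φ x ≤ g x} := by ext; simp [and_comm]
      rw [this]
      exact isClosed_Icc.isClosed_le hφc.continuousOn hg
    · simpa [φ] using ha
    · rintro x ⟨hx, hxab⟩ y hy
      have hxI : x ∈ Icc a b := Ico_subset_Icc_self hxab
      have hnb : 𝓝[>] x ≤ 𝓝[Icc a b] x := by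
        rw [← nhdsWithin_Ioo_eq_nhdsGT hxab.2]
        exact nhdsWithin_mono _ fun z hz => ⟨hxab.1.trans hz.1.le, hz.2.le⟩
      -- Strictly above the barrier continuity suffices; at a contact point the derivative of `g`
      -- exceeds the slope `σ`.
      have hev : ∀ᶠ z in 𝓝[>] x, φ z ≤ g z := by
        rcases (show φ x ≤ g x from hx).lt_or_eq with h | h
        · have h1 : Tendsto (fun z => g z - φ z) (𝓝[>] x) (𝓝 (g x - φ x)) :=
            (((hg x hxI).sub hφc.continuousWithinAt).mono_left hnb)
          filter_upwards [h1.eventually_const_lt (sub_pos.2 h)] with z hz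
          linarith
        · obtain ⟨D, hD, hκD⟩ := hd x hxab (h ▸ (hφI x hxI).1) (h ▸ (hφI x hxI).2)
          have h1 : Tendsto (slope g x) (𝓝[>] x) (𝓝 D) := by
            refine (hasDerivWithinAt_iff_tendsto_slope.1 hD).mono_left ?_
            rw [← nhdsWithin_Ioo_eq_nhdsGT hxab.2]
            exact nhdsWithin_mono _ fun z hz => ⟨⟨hxab.1.trans hz.1.le, hz.2.le⟩, hz.1.ne'⟩
          filter_upwards [h1.eventually_const_lt (hσκ.trans_le hκD), self_mem_nhdsWithin] with z hz hzx
          have hzx' : 0 < z - x := sub_pos.2 hzx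
          rw [slope_def_field, lt_div_iff₀ hzx'] at hz
          have : φ z = φ x + σ * (z - x) := by simp only [φ]; ring
          linarith
      obtain ⟨z, hz, hz2⟩ := (hev.and (Ioc_mem_nhdsGT hy)).exists
      exact ⟨z, hz, hz2⟩
  have := hsub (right_mem_Icc.2 hab)
  rw [mem_ofPred_eq, hφb] at this
  exact this

/-- The hypothesis on the derivatives: wherever `g` has a value in `]A, B[`, the derivative exists
and lies between `m` and `M`. -/
lemma le_of_deriv_mem_Icc {g : ℝ → ℝ} {A B m M c v s t h : ℝ}
    (hg : ContinuousOn g (Icc 0 1))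
    (hd : ∀ x ∈ Icc (0 : ℝ) 1, A < g x → g x < B →
      ∃ D, HasDerivWithinAt g D (Icc 0 1) x ∧ m ≤ D ∧ D ≤ M)
    (hM : 0 < M) (hm : 0 ≤ m) (hc : c ∈ Ioo A B) (hv : v ∈ Ioo A B) (hh : 0 < h)
    (hs : s ∈ Icc (0 : ℝ) 1) (ht : t ∈ Icc (0 : ℝ) 1)
    (hst : s - t ≤ h) (hcv : v ≤ c - 2 * M * h) (hgs : c ≤ g s) : v ≤ g t := by
  have hMh : 0 < M * h := mul_pos hM hh
  rcases le_total s t with hle | hle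
  · refine le_of_deriv_lower_bound (κ := m) hle (hg.mono (Icc_subset_Icc hs.1 ht.2)) ?_ hc hv
      (fun _ => by linarith) (fun _ => ?_) hgs
    · intro x hx h1 h2
      obtain ⟨D, hD, h3, -⟩ := hd x ⟨hs.1.trans hx.1, hx.2.le.trans ht.2⟩ h1 h2
      exact ⟨D, hD.mono (Icc_subset_Icc hs.1 ht.2), h3⟩
    · have : 0 ≤ m * (t - s) := mul_nonneg hm (sub_nonneg.2 hle)
      linarith
  -- Moving to the left is reduced to the barrier by reflection, the slope being then at least `-M`.
  -- The drop is allowed to be `2Mh` instead of `Mh` because the barrier needs a strict inequality.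
  · have hmaps : MapsTo (fun x : ℝ => -x) (Icc (-s) (-t)) (Icc 0 1) := fun x hx =>
      ⟨by linarith [hx.2, ht.1], by linarith [hx.1, hs.2]⟩
    have key := le_of_deriv_lower_bound (g := fun x => g (-x)) (κ := -M) (A := A) (B := B)
      (neg_le_neg hle) (hg.comp continuous_neg.continuousOn hmaps) ?_ hc hv
      (fun _ => by linarith) (fun hlt => ?_) (by simpa using hgs)
    · simpa using key
    · intro x hx h1 h2
      obtain ⟨D, hD, -, h3⟩ := hd (-x) (hmaps (Ico_subset_Icc_self hx)) h1 h2
      refine ⟨-D, ?_, neg_le_neg h3⟩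
      have := HasDerivWithinAt.comp x hD (hasDerivWithinAt_neg x (Icc (-s) (-t))) hmaps
      rwa [mul_neg_one] at this
    · have : M * (s - t) ≤ M * h := mul_le_mul_of_nonneg_left hst hM.le
      linarith

/-- The comparison of the values at two points of the unit cube, one of which is above the other
by `γ` in the coordinate `i₀` and not below it by more than `h` in the others. -/
lemma le_of_partialDeriv_mem_Icc {ι : Type*} [Fintype ι] [DecidableEq ι] {F : (ι → ℝ) → ℝ}
    {A B m M c γ h : ℝ} (hF : ContinuousOn F (Icc 0 1))
    (hd : ∀ t ∈ Icc (0 : ι → ℝ) 1, A < F t → F t < B → ∀ i, ∃ D,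
      HasDerivWithinAt (fun r => F (Function.update t i r)) D (Icc 0 1) (t i) ∧ m ≤ D ∧ D ≤ M)
    (hm : 0 < m) (hM : 0 < M) (hh : 0 < h) (hγ : 0 < γ)
    {s t : ι → ℝ} (hs : s ∈ Icc (0 : ι → ℝ) 1) (ht : t ∈ Icc (0 : ι → ℝ) 1)
    (i₀ : ι) (hi₀ : γ ≤ t i₀ - s i₀) (hst : ∀ i, s i - t i ≤ h)
    (hcA : A < c) (hcs : c ≤ F s) {v : ℝ} (hcv : c ≤ v)
    (hvB : v + 2 * M * h * Fintype.card ι < B)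
    (hv : v + 2 * M * h * Fintype.card ι - c < m * γ) : v ≤ F t := by
  have hup : ∀ {t : ι → ℝ}, t ∈ Icc (0 : ι → ℝ) 1 → ∀ i, ∀ r ∈ Icc (0 : ℝ) 1,
      Function.update t i r ∈ Icc (0 : ι → ℝ) 1 := by
    intro t ht i r hr
    constructor
    · exact le_update_iff.2 ⟨hr.1, fun j _ => ht.1 j⟩
    · exact update_le_iff.2 ⟨hr.2, fun j _ => ht.2 j⟩
  have hcont : ∀ {t : ι → ℝ}, t ∈ Icc (0 : ι → ℝ) 1 → ∀ i,
      ContinuousOn (fun r => F (Function.update t i r)) (Icc 0 1) := fun ht i =>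
    hF.comp (Continuous.continuousOn (by fun_prop)) fun r hr => hup ht i r hr
  have hder : ∀ {t : ι → ℝ}, t ∈ Icc (0 : ι → ℝ) 1 → ∀ i, ∀ x ∈ Icc (0 : ℝ) 1,
      A < F (Function.update t i x) → F (Function.update t i x) < B → ∃ D,
      HasDerivWithinAt (fun r => F (Function.update t i r)) D (Icc 0 1) x ∧ m ≤ D ∧ D ≤ M := by
    intro t ht i x hx h1 h2
    simpa using hd _ (hup ht i x hx) h1 h2 i
  have hmem : ∀ {t : ι → ℝ}, t ∈ Icc (0 : ι → ℝ) 1 → ∀ i, t i ∈ Icc (0 : ℝ) 1 := fun ht i =>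
    ⟨ht.1 i, ht.2 i⟩
  -- The rise of the coordinate `i₀` must reach a level with a reserve of `2Mh` for each of the `N`
  -- coordinates, which are then changed one by one. Only lower bounds are followed, so values of
  -- `F` beyond the upper end of the window do no harm.
  set N : ℝ := (Fintype.card ι : ℝ)
  have hN : 0 ≤ N := Nat.cast_nonneg _
  have hMh : 0 < 2 * M * h := by positivity
  have hMN : 0 ≤ 2 * M * h * N := by positivity
  -- the first step
  have h0 : v + 2 * M * h * N ≤ F (Function.update s i₀ (t i₀)) := by
    refine le_of_deriv_lower_bound (g := fun r => F (Function.update s i₀ r)) (a := s i₀)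
      (κ := m) (A := A) (B := B) (c := c) (by linarith)
      ((hcont hs i₀).mono (Icc_subset_Icc (hs.1 i₀) (ht.2 i₀))) ?_ ⟨hcA, by linarith⟩
      ⟨by linarith, hvB⟩ (fun e => by linarith) (fun _ => ?_) (by simpa using hcs)
    · intro x hx h1 h2
      obtain ⟨D, hD, h3, -⟩ := hder hs i₀ x ⟨(hs.1 i₀).trans hx.1, hx.2.le.trans (ht.2 i₀)⟩ h1 h2
      exact ⟨D, hD.mono (Icc_subset_Icc (hs.1 i₀) (ht.2 i₀)), h3⟩
    · exact hv.trans_le (mul_le_mul_of_nonneg_left hi₀ hm.le)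
  -- the other steps
  have hstep : ∀ T : Finset ι,
      v + 2 * M * h * (N - T.card) ≤ F (T.piecewise t (Function.update s i₀ (t i₀))) := by
    intro T
    induction T using Finset.induction_on with
    | empty => simpa using h0
    | insert i T hi ih =>
      have hmemT : T.piecewise t (Function.update s i₀ (t i₀)) ∈ Icc (0 : ι → ℝ) 1 :=
        ⟨Finset.le_piecewise_of_le_of_le T ht.1 (hup hs i₀ _ (hmem ht i₀)).1,
          Finset.piecewise_le_of_le_of_le T ht.2 (hup hs i₀ _ (hmem ht i₀)).2⟩
      have hcard : (T.card : ℝ) + 1 ≤ (Fintype.card ι : ℝ) := by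
        have : T.card < Fintype.card ι := Finset.card_lt_univ_of_notMem hi
        exact_mod_cast this
      change (T.card : ℝ) + 1 ≤ N at hcard
      have hTc : (0 : ℝ) ≤ T.card := Nat.cast_nonneg _
      rw [Finset.piecewise_insert, Finset.card_insert_of_notMem hi]
      push_cast
      refine le_of_deriv_mem_Icc
        (g := fun r => F (Function.update (T.piecewise t (Function.update s i₀ (t i₀))) i r))
        (s := T.piecewise t (Function.update s i₀ (t i₀)) i) (A := A) (B := B) (m := m)
        (hcont hmemT i) (hder hmemT i) hM hm.le
        (c := v + 2 * M * h * (N - T.card)) ⟨?_, ?_⟩ ⟨?_, ?_⟩ hh (hmem hmemT i) (hmem ht i) ?_ ?_ ?_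
      · nlinarith
      · nlinarith
      · nlinarith
      · nlinarith
      · rw [Finset.piecewise_eq_of_notMem _ _ _ hi]
        -- The coordinate `i₀` already has its final value, but it is given its share of the reserve
        -- all the same.
        rcases eq_or_ne i i₀ with rfl | hne
        · simpa using hh.le
        · simpa [hne] using hst i
      · linarith
      · simpa using ih
  simpa [N] using hstep Finset.univ

/-! ## Test functions and the weak form of the eigenvalue equation -/

section WeakForm
variable {d : ℕ} {Λ : Set (Sp d)}

lemma IsTest.memLp {ψ : Sp d → ℂ} (h : IsTest Λ ψ) (μ : Measure (Sp d))
    [IsFiniteMeasureOnCompacts μ] : MemLp ψ 2 μ :=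
  h.1.continuous.memLp_of_hasCompactSupport h.2.1

lemma IsTest.continuous_fderiv {ψ : Sp d → ℂ} (h : IsTest Λ ψ) : Continuous (fderiv ℝ ψ) :=
  h.1.continuous_fderiv (by simp)

lemma IsTest.memLp_partialDeriv {ψ : Sp d → ℂ} (h : IsTest Λ ψ) (i : Fin d) (μ : Measure (Sp d))
    [IsFiniteMeasureOnCompacts μ] : MemLp (partialDeriv i ψ) 2 μ := by
  have h1 : Continuous (partialDeriv i ψ) := h.continuous_fderiv.clm_apply continuous_const
  refine h1.memLp_of_hasCompactSupport ?_
  exact (h.2.1.fderiv ℝ).comp_left (g := fun L : Sp d →L[ℝ] ℂ => L (EuclideanSpace.single i 1)) rfl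

/-- The weak equation is bilinear in the solution and the test function; conjugate test functions
turn it into an identity between inner products. -/
lemma IsTest.conj {ψ : Sp d → ℂ} (h : IsTest Λ ψ) :
    IsTest Λ fun y => (starRingEnd ℂ) (ψ y) := by
  refine ⟨Complex.conjCLE.contDiff.comp h.1, h.2.1.comp_left (map_zero _), ?_⟩
  exact (tsupport_comp_subset (map_zero (starRingEnd ℂ)) ψ).trans h.2.2

lemma IsTest.partialDeriv_conj {ψ : Sp d → ℂ} (h : IsTest Λ ψ) (i : Fin d) (y : Sp d) :
    partialDeriv i (fun y => (starRingEnd ℂ) (ψ y)) y = (starRingEnd ℂ) (partialDeriv i ψ y) := by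
  have h1 : HasFDerivAt ψ (fderiv ℝ ψ y) y := (h.1.differentiable (by simp) y).hasFDerivAt
  have h2 := (Complex.conjCLE : ℂ →L[ℝ] ℂ).hasFDerivAt.comp y h1
  have h3 : fderiv ℝ (fun y => (starRingEnd ℂ) (ψ y)) y = _ := h2.fderiv
  rw [partialDeriv, h3]
  rfl

/-- The approximation of an element of `H¹₀` and of its gradient by test functions, in `L²`. -/
lemma HasGradient₀.exists_tendsto {φ : L2 Λ} {G : Fin d → L2 Λ} (h : HasGradient₀ Λ φ G) :
    ∃ (ψ : ℕ → Sp d → ℂ) (hψ : ∀ n, IsTest Λ (ψ n)),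
      Tendsto (fun n => ((hψ n).memLp (volume.restrict Λ)).toLp) atTop (𝓝 φ) ∧
      ∀ i, Tendsto (fun n => ((hψ n).memLp_partialDeriv i (volume.restrict Λ)).toLp) atTop
        (𝓝 (G i)) := by
  obtain ⟨ψ, hψ, h1, h2⟩ := h
  refine ⟨ψ, hψ, ?_, fun i => ?_⟩
  · rw [← Lp.toLp_coeFn φ (Lp.memLp φ), Lp.tendsto_Lp_iff_tendsto_eLpNorm'' _ fun n => (hψ n).memLp _]
    exact h1
  · rw [← Lp.toLp_coeFn (G i) (Lp.memLp (G i)),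
      Lp.tendsto_Lp_iff_tendsto_eLpNorm'' _ fun n => (hψ n).memLp_partialDeriv i _]
    exact h2 i

lemma inner_toLp {ψ : Sp d → ℂ} (hψ : MemLp ψ 2 (volume.restrict Λ)) (f : L2 Λ) :
    inner ℂ hψ.toLp f = ∫ y in Λ, f y * (starRingEnd ℂ) (ψ y) := by
  rw [L2.inner_def]
  refine integral_congr_ae ?_
  filter_upwards [hψ.coeFn_toLp] with y hy
  rw [hy, RCLike.inner_apply]

/-- The weak form of the equation `(-Δ_Λ + V) φ = f`, with `X = V φ`, tested against the elements
of `H¹₀`. -/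
lemma SchrodingerEq.exists_inner_eq {V : Sp d → ℝ} {φ f X : L2 Λ} (h : SchrodingerEq Λ V φ f)
    (hX : X =ᵐ[volume.restrict Λ] fun y => (V y : ℂ) * φ y) :
    ∃ G : Fin d → L2 Λ, HasGradient₀ Λ φ G ∧ ∀ (φ' : L2 Λ) (G' : Fin d → L2 Λ),
      HasGradient₀ Λ φ' G' → ∑ i, inner ℂ (G' i) (G i) + inner ℂ φ' X = inner ℂ φ' f := by
  obtain ⟨G, hG, hw⟩ := h
  refine ⟨G, hG, fun φ' G' hG' => ?_⟩
  obtain ⟨ψ, hψ, h1, h2⟩ := hG'.exists_tendsto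
  have key : ∀ n, ∑ i, inner ℂ ((hψ n).memLp_partialDeriv i (volume.restrict Λ)).toLp (G i)
      + inner ℂ ((hψ n).memLp (volume.restrict Λ)).toLp X
      = inner ℂ ((hψ n).memLp (volume.restrict Λ)).toLp f := by
    intro n
    have := hw _ (hψ n).conj
    simp only [(hψ n).partialDeriv_conj] at this
    simp only [inner_toLp]
    rw [← this]
    congr 1
    refine integral_congr_ae ?_
    filter_upwards [hX] with y hy
    rw [hy]
  refine tendsto_nhds_unique (f := fun n => _) (Tendsto.congr key ?_)
    (h1.inner tendsto_const_nhds)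
  exact (tendsto_finsetSum _ fun i _ => (h2 i).inner tendsto_const_nhds).add
    (h1.inner tendsto_const_nhds)

/-- The product of an element of `L²` and a bounded function. -/
lemma exists_mul_bounded {V : Sp d → ℝ} (hV : AEStronglyMeasurable V (volume.restrict Λ)) {K : ℝ}
    (hVK : ∀ᵐ y ∂volume.restrict Λ, |V y| ≤ K) (φ : L2 Λ) :
    ∃ X : L2 Λ, X =ᵐ[volume.restrict Λ] (fun y => (V y : ℂ) * φ y) ∧ ‖X‖ ≤ K * ‖φ‖ := by
  have hm : AEStronglyMeasurable (fun y => (V y : ℂ) * φ y) (volume.restrict Λ) :=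
    (Complex.continuous_ofReal.comp_aestronglyMeasurable hV).mul (Lp.aestronglyMeasurable φ)
  have hb : ∀ᵐ y ∂volume.restrict Λ, ‖(V y : ℂ) * φ y‖ ≤ K * ‖φ y‖ := by
    filter_upwards [hVK] with y hy
    rw [norm_mul, Complex.norm_real, Real.norm_eq_abs]
    gcongr
  have hL : MemLp (fun y => (V y : ℂ) * φ y) 2 (volume.restrict Λ) :=
    (Lp.memLp φ).of_le_mul hm hb
  refine ⟨hL.toLp, hL.coeFn_toLp, ?_⟩
  refine Lp.norm_le_mul_norm_of_ae_le_mul ?_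
  filter_upwards [hb, hL.coeFn_toLp] with y hy hy2
  rw [hy2]; exact hy

/-- Two eigenfunctions of operators which differ by the potential `V - V'`. -/
lemma sub_mul_inner_eq {V V' : Sp d → ℝ} {φ φ' X X' : L2 Λ} {E E' : ℝ}
    (h : SchrodingerEq Λ V φ ((E : ℂ) • φ)) (h' : SchrodingerEq Λ V' φ' ((E' : ℂ) • φ'))
    (hX : X =ᵐ[volume.restrict Λ] fun y => (V y : ℂ) * φ y)
    (hX' : X' =ᵐ[volume.restrict Λ] fun y => (V' y : ℂ) * φ y)
    (hV' : AEStronglyMeasurable V' (volume.restrict Λ)) {K : ℝ}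
    (hVK : ∀ᵐ y ∂volume.restrict Λ, |V' y| ≤ K) :
    ((E - E' : ℝ) : ℂ) * inner ℂ φ' φ = inner ℂ φ' (X - X') := by
  obtain ⟨Y, hY, -⟩ := exists_mul_bounded hV' hVK φ'
  obtain ⟨G, hG, h1⟩ := h.exists_inner_eq hX
  obtain ⟨G', hG', h2⟩ := h'.exists_inner_eq hY
  -- Each equation is tested with the other eigenfunction. After conjugating the second one the
  -- gradient terms agree and cancel in the difference.
  have e1 := h1 φ' G' hG'
  have e2 := congrArg (starRingEnd ℂ) (h2 φ G hG)
  simp only [map_add, map_sum, inner_conj_symm, inner_smul_right, map_mul, Complex.conj_ofReal]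
    at e1 e2
  have e3 : inner ℂ Y φ = inner ℂ φ' X' := by
    rw [L2.inner_def, L2.inner_def]
    refine integral_congr_ae ?_
    filter_upwards [hX', hY] with y hy hy2
    rw [hy, hy2, RCLike.inner_apply, RCLike.inner_apply, map_mul, Complex.conj_ofReal]
    ring
  rw [e3] at e2
  rw [inner_sub_right]
  push_cast
  linear_combination -e1 + e2

/-- The spectrum of `-Δ_Λ + V'` comes close to every eigenvalue of `-Δ_Λ + V`. -/
lemma exists_abs_sub_le {V V' : Sp d → ℝ} {φ : L2 Λ} (hφ : φ ≠ 0) {E : ℝ}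
    (h : SchrodingerEq Λ V φ ((E : ℂ) • φ)) {E' : ℕ → ℝ} (e : HilbertBasis ℕ ℂ (L2 Λ))
    (he : ∀ τ, SchrodingerEq Λ V' (e τ) ((E' τ : ℂ) • e τ))
    (hV : AEStronglyMeasurable V (volume.restrict Λ))
    (hV' : AEStronglyMeasurable V' (volume.restrict Λ)) {K : ℝ}
    (hVK : ∀ᵐ y ∂volume.restrict Λ, |V y| ≤ K) (hVK' : ∀ᵐ y ∂volume.restrict Λ, |V' y| ≤ K)
    {κ : ℝ} (hκ : 0 ≤ κ) (hVV' : ∀ᵐ y ∂volume.restrict Λ, |V y - V' y| ≤ κ) :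
    ∃ τ, |E - E' τ| ≤ κ := by
  obtain ⟨X, hX, -⟩ := exists_mul_bounded hV hVK φ
  obtain ⟨X', hX', -⟩ := exists_mul_bounded hV' hVK' φ
  obtain ⟨Z, hZ, hZn⟩ := exists_mul_bounded (hV.sub hV') hVV' φ
  have hZX : X - X' = Z := by
    ext1
    filter_upwards [Lp.coeFn_sub X X', hX, hX', hZ] with y h1 h2 h3 h4
    rw [h1, h4, Pi.sub_apply, h2, h3]
    simp [sub_mul]
  by_contra! hcon
  -- The coefficients of `Z = (V - V') φ` are those of `φ` times `E - E' τ`. If all these factors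
  -- exceeded `κ`, Parseval's identity and `‖Z‖ ≤ κ ‖φ‖` would make all the coefficients of `φ`
  -- vanish.
  have hin : ∀ τ, ‖inner ℂ (e τ) Z‖ = |E - E' τ| * ‖inner ℂ (e τ) φ‖ := fun τ => by
    rw [← hZX, ← sub_mul_inner_eq h (he τ) hX hX' hV' hVK', norm_mul, Complex.norm_real,
      Real.norm_eq_abs]
  have hpars : ∀ x : L2 Λ, HasSum (fun τ => ‖inner ℂ (e τ) x‖ ^ 2) (‖x‖ ^ 2) := fun x => by
    have h1 := (e.hasSum_inner_mul_inner x x).mapL Complex.reCLM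
    convert h1 using 1
    · ext τ
      rw [← inner_conj_symm x (e τ), Complex.reCLM_apply, mul_comm, Complex.mul_conj, Complex.normSq_eq_norm_sq]
      exact (Complex.ofReal_re _).symm
    · exact (inner_self_eq_norm_sq (𝕜 := ℂ) x).symm
  have hsum := (hpars Z).sub ((hpars φ).mul_left (κ ^ 2))
  have hle : ‖Z‖ ^ 2 - κ ^ 2 * ‖φ‖ ^ 2 ≤ 0 := by
    rw [← mul_pow]
    exact sub_nonpos.2 (pow_le_pow_left₀ (norm_nonneg _) hZn 2)
  have hterm : ∀ τ, ‖inner ℂ (e τ) Z‖ ^ 2 - κ ^ 2 * ‖inner ℂ (e τ) φ‖ ^ 2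
      = (|E - E' τ| ^ 2 - κ ^ 2) * ‖inner ℂ (e τ) φ‖ ^ 2 := fun τ => by rw [hin]; ring
  have hpos : ∀ τ, 0 < |E - E' τ| ^ 2 - κ ^ 2 := fun τ =>
    sub_pos.2 (pow_lt_pow_left₀ (hcon τ) hκ two_ne_zero)
  have hnn : ∀ τ, 0 ≤ ‖inner ℂ (e τ) Z‖ ^ 2 - κ ^ 2 * ‖inner ℂ (e τ) φ‖ ^ 2 := fun τ => by
    rw [hterm]; exact mul_nonneg (hpos τ).le (sq_nonneg _)
  have h0 : HasSum (fun τ => ‖inner ℂ (e τ) Z‖ ^ 2 - κ ^ 2 * ‖inner ℂ (e τ) φ‖ ^ 2) 0 := by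
    have := le_antisymm hle (hsum.nonneg hnn)
    rwa [this] at hsum
  have hz := (hasSum_zero_iff_of_nonneg hnn).1 h0
  have hc : ∀ τ, inner ℂ (e τ) φ = 0 := fun τ => by
    have := congrFun hz τ
    rw [hterm, Pi.zero_apply] at this
    simpa using (mul_eq_zero.1 this).resolve_left (hpos τ).ne'
  have hn := hpars φ
  simp only [hc, norm_zero, ne_eq, OfNat.ofNat_ne_zero, not_false_eq_true, zero_pow] at hn
  have := hn.unique hasSum_zero
  exact hφ (by simpa using this)

/-- The energy identity. -/
lemma SchrodingerEq.exists_gradient_le {V : Sp d → ℝ} {φ : L2 Λ} {E K : ℝ} (hφ : ‖φ‖ = 1)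
    (h : SchrodingerEq Λ V φ ((E : ℂ) • φ)) (hV : AEStronglyMeasurable V (volume.restrict Λ))
    (hVK : ∀ᵐ y ∂volume.restrict Λ, |V y| ≤ K) :
    ∃ G : Fin d → L2 Λ, HasGradient₀ Λ φ G ∧ ∑ i, ‖G i‖ ^ 2 ≤ E + K := by
  obtain ⟨X, hX, hXn⟩ := exists_mul_bounded hV hVK φ
  obtain ⟨G, hG, h1⟩ := h.exists_inner_eq hX
  refine ⟨G, hG, ?_⟩
  have e := congrArg Complex.re (h1 φ G hG)
  rw [inner_smul_right, Complex.add_re, Complex.re_sum, Complex.re_ofReal_mul] at e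
  have e1 : ∀ x : L2 Λ, (inner ℂ x x).re = ‖x‖ ^ 2 := fun x => inner_self_eq_norm_sq (𝕜 := ℂ) x
  simp only [e1, hφ] at e
  have h2 : |(inner ℂ φ X).re| ≤ K := by
    refine (Complex.abs_re_le_norm _).trans ((norm_inner_le_norm _ _).trans ?_)
    rw [hφ] at hXn ⊢
    linarith
  have := (abs_le.1 h2).1
  linarith

end WeakForm

/-! ## Compactness: finitely many orthonormal functions of bounded energy -/

lemma enorm_integral_sq_le {α F : Type*} {m : MeasurableSpace α} {ν : Measure α}
    [IsProbabilityMeasure ν] [NormedAddCommGroup F] [NormedSpace ℝ F] {f : α → F}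
    (hf : AEStronglyMeasurable f ν) : ‖∫ a, f a ∂ν‖ₑ ^ 2 ≤ ∫⁻ a, ‖f a‖ₑ ^ 2 ∂ν := by
  have h1 := eLpNorm_le_eLpNorm_of_exponent_le (p := 1) (q := 2) (by norm_num) hf
  rw [eLpNorm_one_eq_lintegral_enorm] at h1
  have h2 := eLpNorm_nnreal_pow_eq_lintegral (f := f) (μ := ν) (p := 2) two_ne_zero
  simp only [NNReal.coe_ofNat, ENNReal.rpow_ofNat, ENNReal.coe_ofNat] at h2
  rw [← h2]
  gcongr
  exact (enorm_integral_le_lintegral_enorm f).trans h1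

section Translation
variable {d : ℕ} {ψ : Sp d → ℂ}

/-- The increment is the integral of the derivative along the segment from `x` to `x + y`; Jensen's
inequality and translation invariance give the bound. -/
lemma lintegral_translate_sub_sq_le (hψ : ContDiff ℝ 1 ψ) (y : Sp d) :
    ∫⁻ x, ‖ψ (x + y) - ψ x‖ₑ ^ 2 ≤ ‖y‖ₑ ^ 2 * ∫⁻ x, ‖fderiv ℝ ψ x‖ₑ ^ 2 := by
  have hc : Continuous (fderiv ℝ ψ) := hψ.continuous_fderiv one_ne_zero
  have : IsProbabilityMeasure (volume.restrict (Ioc (0 : ℝ) 1)) := ⟨by simp⟩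
  have hpt : ∀ x, ‖ψ (x + y) - ψ x‖ₑ ^ 2
      ≤ ∫⁻ t in Ioc (0 : ℝ) 1, ‖y‖ₑ ^ 2 * ‖fderiv ℝ ψ (x + t • y)‖ₑ ^ 2 := by
    intro x
    have hcx : Continuous fun t : ℝ => fderiv ℝ ψ (x + t • y) y := by fun_prop
    have h1 : ∫ t in (0 : ℝ)..1, fderiv ℝ ψ (x + t • y) y = ψ (x + y) - ψ x := by
      rw [intervalIntegral.integral_eq_sub_of_hasDerivAt (f := fun t : ℝ => ψ (x + t • y)) _
        (hcx.intervalIntegrable _ _)]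
      · simp
      · intro t _
        have h2 : HasDerivAt (fun t : ℝ => x + t • y) y t := by
          simpa using ((hasDerivAt_id t).smul_const y).const_add x
        exact ((hψ.differentiable one_ne_zero _).hasFDerivAt).comp_hasDerivAt t h2
    rw [← h1, intervalIntegral.integral_of_le zero_le_one]
    refine (enorm_integral_sq_le hcx.aestronglyMeasurable).trans (lintegral_mono fun t => ?_)
    rw [← mul_pow, mul_comm]
    gcongr
    exact ContinuousLinearMap.le_opENorm _ _
  calc ∫⁻ x, ‖ψ (x + y) - ψ x‖ₑ ^ 2
      ≤ ∫⁻ x, ∫⁻ t in Ioc (0 : ℝ) 1, ‖y‖ₑ ^ 2 * ‖fderiv ℝ ψ (x + t • y)‖ₑ ^ 2 := lintegral_mono hpt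
    _ = ∫⁻ t in Ioc (0 : ℝ) 1, ∫⁻ x, ‖y‖ₑ ^ 2 * ‖fderiv ℝ ψ (x + t • y)‖ₑ ^ 2 := by
        refine lintegral_lintegral_swap ?_
        have : Continuous fun q : Sp d × ℝ => fderiv ℝ ψ (q.1 + q.2 • y) := by fun_prop
        exact ((this.measurable.enorm.pow_const 2).const_mul _).aemeasurable
    _ = ∫⁻ t in Ioc (0 : ℝ) 1, ‖y‖ₑ ^ 2 * ∫⁻ x, ‖fderiv ℝ ψ x‖ₑ ^ 2 := by
        refine lintegral_congr fun t => ?_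
        rw [lintegral_const_mul]
        · rw [lintegral_add_right_eq_self (fun x => ‖fderiv ℝ ψ x‖ₑ ^ 2)]
        · exact (hc.comp (continuous_add_const _)).measurable.enorm.pow_const 2
    _ = _ := by simp

lemma enorm_fderiv_sq_le (x : Sp d) :
    ‖fderiv ℝ ψ x‖ₑ ^ 2 ≤ ∑ i, ‖partialDeriv i ψ x‖ₑ ^ 2 := by
  have h : ‖fderiv ℝ ψ x‖ ≤ Real.sqrt (∑ i, ‖partialDeriv i ψ x‖ ^ 2) := by
    refine ContinuousLinearMap.opNorm_le_bound _ (Real.sqrt_nonneg _) fun v => ?_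
    have hv : v = ∑ i, v i • EuclideanSpace.single i (1 : ℝ) := by
      ext j; simp [Finset.sum_apply, Pi.single_apply]
    calc ‖fderiv ℝ ψ x v‖ = ‖∑ i, v i • partialDeriv i ψ x‖ := by
          conv_lhs => rw [hv]
          simp [partialDeriv]
      _ ≤ ∑ i, ‖partialDeriv i ψ x‖ * ‖v i‖ := by
          refine (norm_sum_le _ _).trans (Finset.sum_le_sum fun i _ => ?_)
          rw [norm_smul, mul_comm]
      _ ≤ Real.sqrt (∑ i, ‖partialDeriv i ψ x‖ ^ 2) * Real.sqrt (∑ i, ‖v i‖ ^ 2) :=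
          Real.sum_mul_le_sqrt_mul_sqrt _ _ _
      _ = _ := by rw [EuclideanSpace.norm_eq v]
  have h2 : ‖fderiv ℝ ψ x‖ ^ 2 ≤ ∑ i, ‖partialDeriv i ψ x‖ ^ 2 :=
    (Real.le_sqrt (norm_nonneg _) (Finset.sum_nonneg fun i _ => sq_nonneg _)).1 h
  simp only [← ofReal_norm, ← ENNReal.ofReal_pow (norm_nonneg _)]
  rw [← ENNReal.ofReal_sum_of_nonneg fun i _ => sq_nonneg _]
  exact ENNReal.ofReal_le_ofReal h2

end Translation

lemma enorm_add_sq_le {F : Type*} [NormedAddCommGroup F] (a b : F) :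
    ‖a + b‖ₑ ^ 2 ≤ 2 * ‖a‖ₑ ^ 2 + 2 * ‖b‖ₑ ^ 2 := by
  have h : ‖a + b‖ ^ 2 ≤ 2 * ‖a‖ ^ 2 + 2 * ‖b‖ ^ 2 := by
    nlinarith [norm_add_le a b, norm_nonneg (a + b), sq_nonneg (‖a‖ - ‖b‖), norm_nonneg a,
      norm_nonneg b]
  simp only [← ofReal_norm, ← ENNReal.ofReal_pow (norm_nonneg _)]
  rw [← ENNReal.ofReal_ofNat, ← ENNReal.ofReal_mul (by norm_num), ← ENNReal.ofReal_mul (by norm_num),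
    ← ENNReal.ofReal_add (by positivity) (by positivity)]
  exact ENNReal.ofReal_le_ofReal h

section Averages
variable {d : ℕ} {Λ : Set (Sp d)}

/-- The uniform probability measure on the ball of radius `h` centered at the origin. -/
def ballMeasure (d : ℕ) (h : ℝ) : Measure (Sp d) := cond volume (Metric.ball (0 : Sp d) h)

lemma isProbabilityMeasure_ballMeasure {h : ℝ} (hh : 0 < h) :
    IsProbabilityMeasure (ballMeasure d h) :=
  cond_isProbabilityMeasure_of_finite (Metric.measure_ball_pos volume 0 hh).ne'
    measure_ball_lt_top.ne

lemma integral_ballMeasure (ψ : Sp d → ℂ) {h : ℝ} (x : Sp d) :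
    ∫ y, ψ (x + y) ∂ballMeasure d h =
      ((volume (Metric.ball (0 : Sp d) h)).toReal⁻¹ : ℝ) • ∫ y in Metric.ball x h, ψ y := by
  rw [ballMeasure, ProbabilityTheory.cond, integral_smul_measure, ENNReal.toReal_inv]
  congr 1
  have e : (fun y => x + y) ⁻¹' Metric.ball x h = Metric.ball 0 h := by
    ext y; simp [Metric.mem_ball, dist_eq_norm]
  rw [← e]
  exact (measurePreserving_add_left volume x).setIntegral_preimage_emb
    (Homeomorph.addLeft x).measurableEmbedding ψ _

/-- A test function is, up to its oscillation on the scale `h`, its local average. -/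
lemma lintegral_oscillation_le {ψ : Sp d → ℂ} (hψ : IsTest Λ ψ) {h : ℝ} (hh : 0 < h) :
    ∫⁻ x, ∫⁻ y, ‖ψ (x + y) - ψ x‖ₑ ^ 2 ∂ballMeasure d h
      ≤ ENNReal.ofReal h ^ 2 * ∑ i, ∫⁻ x, ‖partialDeriv i ψ x‖ₑ ^ 2 := by
  have := isProbabilityMeasure_ballMeasure (d := d) hh
  have hc := hψ.1.continuous
  have hp : ∀ i, Continuous (partialDeriv i ψ) := fun i =>
    hψ.continuous_fderiv.clm_apply continuous_const
  have hball : ∀ᵐ y ∂ballMeasure d h, y ∈ Metric.ball (0 : Sp d) h :=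
    ae_cond_mem measurableSet_ball
  calc ∫⁻ x, ∫⁻ y, ‖ψ (x + y) - ψ x‖ₑ ^ 2 ∂ballMeasure d h
      = ∫⁻ y, ∫⁻ x, ‖ψ (x + y) - ψ x‖ₑ ^ 2 ∂volume ∂ballMeasure d h := by
        refine lintegral_lintegral_swap ?_
        have : Continuous fun q : Sp d × Sp d => ψ (q.1 + q.2) - ψ q.1 := by fun_prop
        exact (this.measurable.enorm.pow_const 2).aemeasurable
    _ ≤ ∫⁻ _y, (ENNReal.ofReal h ^ 2 * ∑ i, ∫⁻ x, ‖partialDeriv i ψ x‖ₑ ^ 2) ∂ballMeasure d h := by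
        refine lintegral_mono_ae ?_
        filter_upwards [hball] with y hy
        refine (lintegral_translate_sub_sq_le (hψ.1.of_le (by simp)) y).trans ?_
        gcongr
        · rw [← ofReal_norm]
          exact ENNReal.ofReal_le_ofReal (mem_ball_zero_iff.1 hy).le
        · rw [← lintegral_finsetSum _ fun i _ => (hp i).measurable.enorm.pow_const 2]
          exact lintegral_mono fun x => enorm_fderiv_sq_le x
    _ = _ := by simp

lemma norm_toLp_sq {ψ : Sp d → ℂ} {μ : Measure (Sp d)} (hψ : MemLp ψ 2 μ) :
    ENNReal.ofReal (‖hψ.toLp‖ ^ 2) = ∫⁻ x, ‖ψ x‖ₑ ^ 2 ∂μ := by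
  have h2 := eLpNorm_nnreal_pow_eq_lintegral (f := ψ) (μ := μ) (p := 2) two_ne_zero
  simp only [NNReal.coe_ofNat, ENNReal.rpow_ofNat, ENNReal.coe_ofNat] at h2
  rw [← h2, Lp.norm_toLp, ENNReal.ofReal_pow ENNReal.toReal_nonneg,
    ENNReal.ofReal_toReal hψ.eLpNorm_ne_top]

/-- Bessel's inequality for the local averages of functions close to an orthonormal family. -/
lemma sum_enorm_average_sq_le {ι : Type*} {e : ι → L2 Λ} (he : Orthonormal ℂ e) (F : Finset ι)
    {ψ : ι → Sp d → ℂ} (hψ : ∀ i, IsTest Λ (ψ i)) {r : ℝ}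
    (hr : ∀ i, ‖((hψ i).memLp (volume.restrict Λ)).toLp - e i‖ ≤ r) (hFr : F.card * r ^ 2 ≤ 1)
    {h : ℝ} (hh : 0 < h) (x : Sp d) :
    ∑ i ∈ F, ‖∫ y, ψ i (x + y) ∂ballMeasure d h‖ₑ ^ 2
      ≤ ENNReal.ofReal (4 / (volume (Metric.ball (0 : Sp d) h)).toReal) := by
  set v := (volume (Metric.ball (0 : Sp d) h)).toReal with hv
  have hv0 : 0 < v := ENNReal.toReal_pos (Metric.measure_ball_pos volume 0 hh).ne'
    measure_ball_lt_top.ne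
  have hfin : (volume.restrict Λ) (Metric.ball x h) ≠ ∞ :=
    ((Measure.restrict_apply_le _ _).trans_lt measure_ball_lt_top).ne
  set χ : L2 Λ := indicatorConstLp 2 measurableSet_ball hfin (1 : ℂ) with hχ
  have hχn : ‖χ‖ ^ 2 ≤ v := by
    rw [hχ, norm_indicatorConstLp two_ne_zero ENNReal.ofNat_ne_top, norm_one, one_mul,
      ENNReal.toReal_ofNat, ← Real.sqrt_eq_rpow, Real.sq_sqrt measureReal_nonneg, hv,
      ← Measure.addHaar_ball_center volume x h]
    exact ENNReal.toReal_mono measure_ball_lt_top.ne (Measure.restrict_apply_le _ _)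
  -- As `ψ i` vanishes off `Λ`, its integral over the ball is an inner product with one fixed
  -- element of `L²(Λ)`, to which Bessel's inequality applies.
  have hin : ∀ i, inner ℂ χ ((hψ i).memLp (volume.restrict Λ)).toLp
      = ∫ y in Metric.ball x h, ψ i y := by
    intro i
    rw [hχ, L2.inner_indicatorConstLp_one, setIntegral_congr_ae (g := ψ i) measurableSet_ball]
    · rw [Measure.restrict_restrict measurableSet_ball]
      refine (setIntegral_eq_of_subset_of_forall_sdiff_eq_zero measurableSet_ball
        inter_subset_left ?_).symm
      intro y hy
      by_contra hne
      exact hy.2 ⟨hy.1, (hψ i).2.2 (subset_tsupport _ hne)⟩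
    · filter_upwards [((hψ i).memLp (volume.restrict Λ)).coeFn_toLp] with y hy _
      exact hy
  have hpt : ∀ i, ‖∫ y in Metric.ball x h, ψ i y‖ ^ 2
      ≤ 2 * ‖inner ℂ (e i) χ‖ ^ 2 + 2 * (v * r ^ 2) := by
    intro i
    set f := ((hψ i).memLp (volume.restrict Λ)).toLp
    have e1 : inner ℂ χ f = inner ℂ χ (e i) + inner ℂ χ (f - e i) := by
      rw [← inner_add_right]; congr 1; abel
    have h1 : ‖inner ℂ χ (f - e i)‖ ^ 2 ≤ v * r ^ 2 := by
      calc ‖inner ℂ χ (f - e i)‖ ^ 2 ≤ (‖χ‖ * ‖f - e i‖) ^ 2 := by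
            gcongr; exact norm_inner_le_norm _ _
        _ = ‖χ‖ ^ 2 * ‖f - e i‖ ^ 2 := by ring
        _ ≤ v * r ^ 2 := by gcongr; exact hr i
    rw [← hin, e1, norm_inner_symm (e i) χ]
    nlinarith [norm_add_le (inner ℂ χ (e i)) (inner ℂ χ (f - e i)),
      norm_nonneg (inner ℂ χ (e i) + inner ℂ χ (f - e i)),
      sq_nonneg (‖inner ℂ χ (e i)‖ - ‖inner ℂ χ (f - e i)‖), norm_nonneg (inner ℂ χ (e i)),
      norm_nonneg (inner ℂ χ (f - e i))]
  have hbessel := he.sum_inner_products_le χ (s := F)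
  have hsum : ∑ i ∈ F, ‖∫ y in Metric.ball x h, ψ i y‖ ^ 2 ≤ 4 * v := by
    calc ∑ i ∈ F, ‖∫ y in Metric.ball x h, ψ i y‖ ^ 2
        ≤ ∑ i ∈ F, (2 * ‖inner ℂ (e i) χ‖ ^ 2 + 2 * (v * r ^ 2)) :=
          Finset.sum_le_sum fun i _ => hpt i
      _ = 2 * ∑ i ∈ F, ‖inner ℂ (e i) χ‖ ^ 2 + 2 * v * (F.card * r ^ 2) := by
          rw [Finset.sum_add_distrib, ← Finset.mul_sum, Finset.sum_const, nsmul_eq_mul]; ring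
      _ ≤ 2 * v + 2 * v * 1 := by gcongr; exact hbessel.trans hχn
      _ = 4 * v := by ring
  simp only [← ofReal_norm, ← ENNReal.ofReal_pow (norm_nonneg _)]
  rw [← ENNReal.ofReal_sum_of_nonneg fun i _ => sq_nonneg _]
  refine ENNReal.ofReal_le_ofReal ?_
  calc ∑ i ∈ F, ‖∫ y, ψ i (x + y) ∂ballMeasure d h‖ ^ 2
      = v⁻¹ ^ 2 * ∑ i ∈ F, ‖∫ y in Metric.ball x h, ψ i y‖ ^ 2 := by
        rw [Finset.mul_sum]
        refine Finset.sum_congr rfl fun i _ => ?_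
        rw [integral_ballMeasure, norm_smul, mul_pow, Real.norm_of_nonneg (by positivity)]
    _ ≤ v⁻¹ ^ 2 * (4 * v) := by gcongr
    _ = 4 / v := by field_simp

/-- A form of Rellich's theorem: in a set of finite measure, an orthonormal family of elements
of `H¹₀` with bounded energy is finite. -/
theorem finite_of_orthonormal_of_gradient_le {ι : Type*} {e : ι → L2 Λ} (he : Orthonormal ℂ e)
    (hΛ : MeasurableSet Λ) (hΛfin : volume Λ ≠ ∞) {R : ℝ}
    (hR : ∀ i, ∃ G : Fin d → L2 Λ, HasGradient₀ Λ (e i) G ∧ ∑ k, ‖G k‖ ^ 2 ≤ R) : Finite ι := by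
  by_contra hinf
  rw [not_finite_iff_infinite] at hinf
  obtain ⟨i₀⟩ : Nonempty ι := inferInstance
  have hR0 : 0 ≤ R := by
    obtain ⟨G, -, h⟩ := hR i₀
    exact (Finset.sum_nonneg fun k _ => sq_nonneg _).trans h
  -- At this scale the oscillation of each function is at most `1/8`. With `|ψ|² ≤ 2 |average|² + 2
  -- oscillation`, Bessel for the averages and `‖ψ‖² ≥ 1/2`, a family of `n` functions satisfies
  -- `n/2 ≤ 8 |Λ| / v + n/4`, which is false for `n > 32 |Λ| / v`.
  set h : ℝ := (Real.sqrt (8 * (R + 1)))⁻¹ with hh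
  have hh0 : 0 < h := by positivity
  have hh2 : h ^ 2 * (R + 1) = 1 / 8 := by
    rw [hh, inv_pow, Real.sq_sqrt (by positivity)]; field_simp
  set v := (volume (Metric.ball (0 : Sp d) h)).toReal with hv
  obtain ⟨n, hn⟩ := exists_nat_gt (32 * (volume Λ).toReal / v)
  obtain ⟨F, hF⟩ := Infinite.exists_subset_card_eq ι n
  -- The error `r` of the approximation by test functions must keep `‖ψ‖² ≥ 1/2`, and its `n`
  -- squares must not spoil Bessel's inequality.
  obtain ⟨r, hr0, hr1, hr2⟩ : ∃ r : ℝ, 0 < r ∧ r ≤ 1 / 4 ∧ n * r ^ 2 ≤ 1 := by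
    refine ⟨1 / (4 * (n + 1)), by positivity, ?_, ?_⟩
    · rw [div_le_div_iff₀ (by positivity) (by norm_num)]
      nlinarith [(Nat.cast_nonneg n : (0 : ℝ) ≤ n)]
    · rw [div_pow, one_pow, mul_one_div, div_le_one (by positivity)]
      nlinarith [(Nat.cast_nonneg n : (0 : ℝ) ≤ n)]
  have hex : ∀ i, ∃ (ψ : Sp d → ℂ) (hψ : IsTest Λ ψ),
      ‖(hψ.memLp (volume.restrict Λ)).toLp - e i‖ ≤ r ∧
      ∑ k, ‖(hψ.memLp_partialDeriv k (volume.restrict Λ)).toLp‖ ^ 2 ≤ R + 1 := by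
    intro i
    obtain ⟨G, hG, hGR⟩ := hR i
    obtain ⟨ψ, hψ, h1, h2⟩ := hG.exists_tendsto
    have h3 : Tendsto (fun n => ‖((hψ n).memLp (volume.restrict Λ)).toLp - e i‖) atTop (𝓝 0) := by
      simpa using (h1.sub_const (e i)).norm
    have h4 := tendsto_finsetSum Finset.univ fun k _ => ((h2 k).norm.pow 2)
    obtain ⟨n, hn1, hn2⟩ := ((h3.eventually_lt_const hr0).and
      (h4.eventually_lt_const (hGR.trans_lt (lt_add_one R)))).exists
    exact ⟨ψ n, hψ n, hn1.le, hn2.le⟩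
  choose ψ hψ hψ1 hψ2 using hex
  have := isProbabilityMeasure_ballMeasure (d := d) hh0
  -- the oscillation
  have hosc : ∀ i, ∫⁻ x, ∫⁻ y, ‖ψ i (x + y) - ψ i x‖ₑ ^ 2 ∂ballMeasure d h
      ≤ ENNReal.ofReal (1 / 8) := by
    intro i
    refine (lintegral_oscillation_le (hψ i) hh0).trans ?_
    have h1 : ∀ k, ∫⁻ x, ‖partialDeriv k (ψ i) x‖ₑ ^ 2
        = ENNReal.ofReal (‖((hψ i).memLp_partialDeriv k (volume.restrict Λ)).toLp‖ ^ 2) := by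
      intro k
      rw [norm_toLp_sq, ← lintegral_indicator hΛ]
      refine lintegral_congr fun x => ?_
      by_cases hx : x ∈ Λ
      · rw [indicator_of_mem hx]
      · rw [indicator_of_notMem hx]
        have : fderiv ℝ (ψ i) x = 0 := by
          by_contra hne
          exact hx ((hψ i).2.2 (support_fderiv_subset ℝ hne))
        simp [partialDeriv, this]
    simp only [h1]
    rw [← ENNReal.ofReal_sum_of_nonneg fun k _ => sq_nonneg _, ← ENNReal.ofReal_pow hh0.le,
      ← ENNReal.ofReal_mul (by positivity), ← hh2]
    exact ENNReal.ofReal_le_ofReal (mul_le_mul_of_nonneg_left (hψ2 i) (by positivity))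
  have hmeas : ∀ i, Measurable fun x => ∫⁻ y, ‖ψ i (x + y) - ψ i x‖ₑ ^ 2 ∂ballMeasure d h := by
    intro i
    have hc := (hψ i).1.continuous
    have : Continuous fun q : Sp d × Sp d => ψ i (q.1 + q.2) - ψ i q.1 := by fun_prop
    exact (this.measurable.enorm.pow_const 2).lintegral_prod_right'
  have hpt : ∀ i x, ‖ψ i x‖ₑ ^ 2 ≤ 2 * ‖∫ y, ψ i (x + y) ∂ballMeasure d h‖ₑ ^ 2 +
      2 * ∫⁻ y, ‖ψ i (x + y) - ψ i x‖ₑ ^ 2 ∂ballMeasure d h := by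
    intro i x
    have hc := (hψ i).1.continuous
    have hint : Integrable (fun y => ψ i (x + y)) (ballMeasure d h) := by
      obtain ⟨C, hC⟩ := hc.bounded_above_of_compact_support (hψ i).2.1
      exact Integrable.of_bound (hc.comp (continuous_const.add continuous_id)).aestronglyMeasurable
        C (.of_forall fun y => hC _)
    have e1 : ψ i x = ∫ y, ψ i (x + y) ∂ballMeasure d h +
        -∫ y, (ψ i (x + y) - ψ i x) ∂ballMeasure d h := by
      rw [integral_sub hint (integrable_const _)]; simp
    calc ‖ψ i x‖ₑ ^ 2 = ‖∫ y, ψ i (x + y) ∂ballMeasure d h +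
          -∫ y, (ψ i (x + y) - ψ i x) ∂ballMeasure d h‖ₑ ^ 2 := by rw [← e1]
      _ ≤ _ := enorm_add_sq_le _ _
      _ ≤ _ := by
          rw [enorm_neg]
          gcongr
          refine enorm_integral_sq_le (Continuous.aestronglyMeasurable ?_)
          fun_prop
  have hlow : ∀ i, ENNReal.ofReal (1 / 2) ≤ ∫⁻ x in Λ, ‖ψ i x‖ₑ ^ 2 := by
    intro i
    rw [← norm_toLp_sq ((hψ i).memLp (volume.restrict Λ))]
    refine ENNReal.ofReal_le_ofReal ?_
    have h1 := norm_sub_norm_le (e i) ((hψ i).memLp (volume.restrict Λ)).toLp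
    rw [norm_sub_rev, he.1 i] at h1
    have h2 := hψ1 i
    nlinarith
  have hup : ∑ i ∈ F, ∫⁻ x in Λ, ‖ψ i x‖ₑ ^ 2
      ≤ 2 * ENNReal.ofReal (4 / v) * volume Λ + 2 * ∑ i ∈ F, ENNReal.ofReal (1 / 8) := by
    have hc := fun i => (hψ i).1.continuous
    rw [← lintegral_finsetSum _ fun i _ => (hc i).measurable.enorm.pow_const 2]
    calc ∫⁻ x in Λ, ∑ i ∈ F, ‖ψ i x‖ₑ ^ 2
        ≤ ∫⁻ x in Λ, (2 * ENNReal.ofReal (4 / v) +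
            2 * ∑ i ∈ F, ∫⁻ y, ‖ψ i (x + y) - ψ i x‖ₑ ^ 2 ∂ballMeasure d h) := by
          refine lintegral_mono fun x => ?_
          refine (Finset.sum_le_sum fun i _ => hpt i x).trans ?_
          rw [Finset.sum_add_distrib, ← Finset.mul_sum, ← Finset.mul_sum]
          gcongr
          exact sum_enorm_average_sq_le he F hψ hψ1 (hF ▸ hr2) hh0 x
      _ = 2 * ENNReal.ofReal (4 / v) * volume Λ +
            2 * ∑ i ∈ F, ∫⁻ x in Λ, ∫⁻ y, ‖ψ i (x + y) - ψ i x‖ₑ ^ 2 ∂ballMeasure d h := by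
          rw [lintegral_add_left measurable_const, lintegral_const_mul _
            (Finset.measurable_fun_sum _ fun i _ => hmeas i),
            lintegral_finsetSum _ fun i _ => hmeas i]
          simp
      _ ≤ _ := by
          gcongr with i _
          exact (setLIntegral_le_lintegral _ _).trans (hosc i)
  have hfinal := (Finset.sum_le_sum fun i (_ : i ∈ F) => hlow i).trans hup
  have hv0 : 0 < v := ENNReal.toReal_pos (Metric.measure_ball_pos volume 0 hh0).ne'
    measure_ball_lt_top.ne
  simp only [Finset.sum_const, hF, nsmul_eq_mul] at hfinal
  have hreal := ENNReal.toReal_mono (by finiteness) hfinal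
  rw [ENNReal.toReal_add (by finiteness) (by finiteness)] at hreal
  simp only [ENNReal.toReal_mul, ENNReal.toReal_natCast,
    ENNReal.toReal_ofNat, ENNReal.toReal_ofReal (show (0 : ℝ) ≤ 1 / 2 by norm_num),
    ENNReal.toReal_ofReal (show (0 : ℝ) ≤ 1 / 8 by norm_num),
    ENNReal.toReal_ofReal (show (0 : ℝ) ≤ 4 / v by positivity)] at hreal
  have e1 : 2 * (4 / v) * (volume Λ).toReal = 32 * (volume Λ).toReal / v / 4 := by ring
  rw [e1] at hreal
  linarith

end Averages

/-! ## The eigenvalues as functions of the potential -/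

/-- The eigenvalues of a Schrödinger operator on a set of finite measure are isolated. -/
lemma exists_eigenvalue_gap {d : ℕ} {Λ : Set (Sp d)} (hΛ : MeasurableSet Λ) (hΛfin : volume Λ ≠ ∞)
    {V : Sp d → ℝ} (hV : AEStronglyMeasurable V (volume.restrict Λ)) {K : ℝ}
    (hVK : ∀ᵐ y ∂volume.restrict Λ, |V y| ≤ K) {E : ℕ → ℝ} (e : HilbertBasis ℕ ℂ (L2 Λ))
    (he : ∀ τ, SchrodingerEq Λ V (e τ) ((E τ : ℂ) • e τ)) (a : ℝ) :
    ∃ g > 0, ∀ n, |E n - a| < g → E n = a := by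
  -- Eigenfunctions with eigenvalue at most `a + 1` have bounded energy, hence are finite in number.
  -- The other eigenvalues are farther than `1` from `a`.
  have hfin : {n | E n ≤ a + 1}.Finite := by
    have : Finite {n | E n ≤ a + 1} := by
      refine finite_of_orthonormal_of_gradient_le (R := a + 1 + K)
        (e.orthonormal.comp (fun n : {n | E n ≤ a + 1} => (n : ℕ)) Subtype.val_injective) hΛ hΛfin ?_
      intro n
      obtain ⟨G, hG, h⟩ := (he n).exists_gradient_le (e.orthonormal.1 n) hV hVK
      exact ⟨G, hG, h.trans (add_le_add_left n.2 K)⟩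
    exact Set.toFinite _
  have hT : ((E '' {n | E n ≤ a + 1}) \ {a}).Finite := (hfin.image E).subset sdiff_subset
  have hn : ((E '' {n | E n ≤ a + 1}) \ {a})ᶜ ∈ 𝓝 a :=
    hT.isClosed.isOpen_compl.mem_nhds (by simp)
  obtain ⟨g, hg, hsub⟩ := Metric.mem_nhds_iff.1 hn
  refine ⟨min g 1, lt_min hg one_pos, fun n h => ?_⟩
  by_contra hne
  refine hsub (show E n ∈ Metric.ball a g from h.trans_le (min_le_left _ _)) ⟨⟨n, ?_, rfl⟩, hne⟩
  have := (abs_lt.1 (h.trans_le (min_le_right _ _))).2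
  rw [mem_ofPred_eq]
  linarith

/-- A continuous eigenvalue branch is Lipschitz continuous along a segment. -/
lemma abs_eigenvalue_sub_le {d : ℕ} {Λ : Set (Sp d)} (hΛ : MeasurableSet Λ) (hΛfin : volume Λ ≠ ∞)
    {V : ℝ → Sp d → ℝ} {E : ℕ → ℝ → ℝ} (hE : IsEigenvalueParametrization Λ (Icc 0 1) V E)
    (hV : ∀ s, AEStronglyMeasurable (V s) (volume.restrict Λ))
    (hVK : ∀ s, ∃ K, ∀ᵐ y ∂volume.restrict Λ, |V s y| ≤ K) {κ : ℝ} (hκ : 0 ≤ κ)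
    (hVV : ∀ s s', ∀ᵐ y ∂volume.restrict Λ, |V s y - V s' y| ≤ κ * |s - s'|) (τ : ℕ) :
    |E τ 1 - E τ 0| ≤ κ := by
  obtain ⟨hcont, hev⟩ := hE
  -- Near `s₀` some eigenvalue at `s₀` is within `κ |s - s₀|` of `E τ s`. By continuity of the
  -- branch it is also within the isolation distance `g` of `E τ s₀`, hence equal to it, perhaps
  -- with another index.
  have hloc : ∀ s₀ ∈ Icc (0 : ℝ) 1, ∀ᶠ s in 𝓝[Icc 0 1] s₀, |E τ s - E τ s₀| ≤ κ * |s - s₀| := by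
    intro s₀ hs₀
    obtain ⟨e, he⟩ := hev s₀ hs₀
    obtain ⟨K, hK⟩ := hVK s₀
    obtain ⟨g, hg, hgap⟩ := exists_eigenvalue_gap hΛ hΛfin (hV s₀) hK e he (E τ s₀)
    have h1 : ∀ᶠ s in 𝓝[Icc 0 1] s₀, |E τ s - E τ s₀| < g / 2 :=
      (hcont τ s₀ hs₀).eventually (Metric.ball_mem_nhds _ (half_pos hg))
    have h2 : ∀ᶠ s in 𝓝[Icc 0 1] s₀, κ * |s - s₀| < g / 2 := by
      have : Tendsto (fun s => κ * |s - s₀|) (𝓝[Icc 0 1] s₀) (𝓝 0) := by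
        have : ContinuousWithinAt (fun s => κ * |s - s₀|) (Icc 0 1) s₀ := by fun_prop
        simpa [ContinuousWithinAt] using this
      exact this.eventually_lt_const (half_pos hg)
    filter_upwards [h1, h2, self_mem_nhdsWithin] with s hs1 hs2 hs
    obtain ⟨e', he'⟩ := hev s hs
    obtain ⟨K', hK'⟩ := hVK s
    obtain ⟨n, hn⟩ := exists_abs_sub_le (e'.orthonormal.ne_zero τ) (he' τ) e he (hV s) (hV s₀)
      (hK'.mono fun y h => h.trans (le_max_left K' K)) (hK.mono fun y h => h.trans (le_max_right K' K))
      (mul_nonneg hκ (abs_nonneg _)) (hVV s s₀)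
    rw [← hgap n]
    · exact hn
    · have := abs_sub_le (E n s₀) (E τ s) (E τ s₀)
      rw [abs_sub_comm (E n s₀) (E τ s)] at this
      linarith
  -- Continuous induction: the set where the bound holds is closed, and the local estimate extends
  -- it to the right.
  have hsub : Icc (0 : ℝ) 1 ⊆ {s | |E τ s - E τ 0| ≤ κ * s} := by
    refine IsClosed.Icc_subset_of_forall_exists_gt ?_ (by simp) ?_
    · have : {s | |E τ s - E τ 0| ≤ κ * s} ∩ Icc 0 1
          = {s ∈ Icc 0 1 | |E τ s - E τ 0| ≤ κ * s} := by ext; simp [and_comm]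
      rw [this]
      exact isClosed_Icc.isClosed_le ((hcont τ).sub continuousOn_const).abs (by fun_prop)
    · rintro x ⟨hx, hx01⟩ y hy
      have hnb : 𝓝[>] x ≤ 𝓝[Icc 0 1] x := by
        rw [← nhdsWithin_Ioo_eq_nhdsGT hx01.2]
        exact nhdsWithin_mono _ fun z hz => ⟨hx01.1.trans hz.1.le, hz.2.le⟩
      obtain ⟨z, hz, hzx⟩ :=
        (((hloc x (Ico_subset_Icc_self hx01)).filter_mono hnb).and (Ioc_mem_nhdsGT hy)).exists
      refine ⟨z, ?_, hzx⟩
      rw [mem_ofPred_eq] at hx ⊢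
      rw [abs_of_pos (sub_pos.2 hzx.1)] at hz
      have := abs_sub_le (E τ z) (E τ x) (E τ 0)
      linarith
  simpa using hsub (right_mem_Icc.2 zero_le_one)

section Box
variable {d : ℕ}

lemma measurableSet_box (x : Sp d) (L : ℝ) : MeasurableSet (box x L) := by
  have : box x L = ⋂ i, {y : Sp d | |y i - x i| < L / 2} := by ext; simp [box]
  rw [this]
  exact .iInter fun i => (isOpen_lt (by fun_prop) continuous_const).measurableSet

lemma volume_box_ne_top (x : Sp d) (L : ℝ) : volume (box x L) ≠ ∞ := by
  have hc : IsCompact ((WithLp.toLp 2 : (Fin d → ℝ) → Sp d) ''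
      Icc (fun i => x i - L / 2) (fun i => x i + L / 2)) :=
    isCompact_Icc.image (PiLp.continuous_toLp 2 _)
  refine ((measure_mono fun y hy => ?_).trans_lt hc.measure_lt_top).ne
  refine ⟨fun i => y i, ⟨fun i => ?_, fun i => ?_⟩, rfl⟩
  · linarith [(abs_lt.1 (hy i)).1]
  · linarith [(abs_lt.1 (hy i)).2]

lemma card_boxSites_le (x : Sp d) {L : ℝ} (hL : 0 ≤ L) :
    ((boxSites x L).card : ℝ) ≤ (L + 3) ^ d := by
  classical
  have h1 : (boxSites x L).card ≤ ∏ i, (Finset.Icc ⌊x i - L / 2⌋ ⌈x i + L / 2⌉).card := by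
    rw [← Fintype.card_piFinset]
    unfold boxSites
    convert Finset.card_filter_le _ _
  have h2 : ∀ i, ((Finset.Icc ⌊x i - L / 2⌋ ⌈x i + L / 2⌉).card : ℝ) ≤ L + 3 := by
    intro i
    rw [Int.card_Icc]
    have e1 := Int.sub_one_lt_floor (x i - L / 2)
    have e2 := Int.ceil_lt_add_one (x i + L / 2)
    have e3 : (0 : ℤ) ≤ ⌈x i + L / 2⌉ + 1 - ⌊x i - L / 2⌋ := by
      have a1 := Int.floor_le (x i - L / 2)
      have a2 := Int.le_ceil (x i + L / 2)
      have : ((⌊x i - L / 2⌋ : ℤ) : ℝ) ≤ ((⌈x i + L / 2⌉ : ℤ) : ℝ) := by linarith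
      have : ⌊x i - L / 2⌋ ≤ ⌈x i + L / 2⌉ := by exact_mod_cast this
      omega
    have e4 : (((⌈x i + L / 2⌉ + 1 - ⌊x i - L / 2⌋).toNat : ℤ) : ℝ)
        = ((⌈x i + L / 2⌉ + 1 - ⌊x i - L / 2⌋ : ℤ) : ℝ) := by rw [Int.toNat_of_nonneg e3]
    rw [Int.cast_natCast] at e4
    rw [e4]
    push_cast
    linarith
  calc ((boxSites x L).card : ℝ) ≤ ((∏ i, (Finset.Icc ⌊x i - L / 2⌋ ⌈x i + L / 2⌉).card : ℕ) : ℝ) :=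
        by exact_mod_cast h1
    _ = ∏ i, ((Finset.Icc ⌊x i - L / 2⌋ ⌈x i + L / 2⌉).card : ℝ) := by push_cast; rfl
    _ ≤ ∏ _i : Fin d, (L + 3) := Finset.prod_le_prod (fun i _ => Nat.cast_nonneg _) fun i _ => h2 i
    _ = _ := by simp

variable {u : Sp d → ℝ} {um up δm δp : ℝ}

lemma IsSingleSite.ae_abs_le (hu : IsSingleSite u um up δm δp) : ∀ᵐ y, |u y| ≤ up := by
  obtain ⟨h1, h2, -, -, -, h⟩ := hu
  filter_upwards [h] with y hy
  rw [abs_le]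
  have a1 : 0 ≤ (box (0 : Sp d) δm).indicator (fun _ => um) y :=
    indicator_nonneg (fun _ _ => h1.le) y
  have a2 : (box (0 : Sp d) δp).indicator (fun _ => up) y ≤ up :=
    indicator_le_self' (fun _ _ => h2.le) y
  constructor <;> linarith [hy.1, hy.2]

lemma IsSingleSite.ae_abs_translate_le (hu : IsSingleSite u um up δm δp) :
    ∀ᵐ y, ∀ ζ : Zd d, |u (y - site ζ)| ≤ up :=
  ae_all_iff.2 fun ζ =>
    (measurePreserving_sub_right volume (site ζ)).quasiMeasurePreserving.ae hu.ae_abs_le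

lemma IsSingleSite.aestronglyMeasurable_potential (hu : IsSingleSite u um up δm δp) (x : Sp d)
    (L : ℝ) (η : Zd d → ℝ) : AEStronglyMeasurable (potential u x L η) volume := by
  unfold potential
  refine Finset.aestronglyMeasurable_fun_sum _ fun ζ _ => AEStronglyMeasurable.const_mul ?_ _
  exact hu.2.2.2.2.1.comp_quasiMeasurePreserving
    (measurePreserving_sub_right volume (site ζ)).quasiMeasurePreserving

lemma IsSingleSite.ae_abs_potential_sub_le (hu : IsSingleSite u um up δm δp) (x : Sp d)
    (L : ℝ) (η η' : Zd d → ℝ) : ∀ᵐ y, |potential u x L η y - potential u x L η' y|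
      ≤ (∑ ζ ∈ boxSites x L, |η ζ - η' ζ|) * up := by
  filter_upwards [hu.ae_abs_translate_le] with y hy
  rw [potential, potential, ← Finset.sum_sub_distrib, Finset.sum_mul]
  refine (Finset.abs_sum_le_sum_abs _ _).trans (Finset.sum_le_sum fun ζ _ => ?_)
  rw [← sub_mul, abs_mul]
  gcongr
  exact hy ζ

/-- The dependence of an eigenvalue on the background configuration. -/
lemma abs_eigenvalue_sub_le_of_segment (hu : IsSingleSite u um up δm δp) {x : Sp d} {L : ℝ}
    {S : Finset (Zd d)} {Q : Set (Zd d → ℝ)} (hQ : Convex ℝ Q)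
    {E : ℕ → (Zd d → ℝ) × (S → ℝ) → ℝ}
    (hE : IsEigenvalueParametrization (box x L) (Q ×ˢ Icc 0 1)
        (fun z => potential u x L (glue S z.1 z.2)) E)
    {ω ω' : Zd d → ℝ} (hω : ω ∈ Q) (hω' : ω' ∈ Q) {t : S → ℝ} (ht : t ∈ Icc (0 : S → ℝ) 1)
    {α : ℝ} (hα : 0 ≤ α) (hωα : ∀ ζ ∈ boxSites x L \ S, |ω' ζ - ω ζ| ≤ α) (τ : ℕ) :
    |E τ (ω', t) - E τ (ω, t)| ≤ (boxSites x L).card * α * up := by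
  have hup : 0 ≤ up := hu.2.1.le
  -- Convexity of `Q` keeps the segment from `ω` to `ω'` in the domain of the parametrization. Only
  -- the sites off `S` move.
  let η : ℝ → Zd d → ℝ := fun s => ω + s • (ω' - ω)
  have hηQ : ∀ s ∈ Icc (0 : ℝ) 1, η s ∈ Q := fun s hs => by
    have := hQ hω hω' (sub_nonneg.2 hs.2) hs.1 (by ring)
    convert this using 1
    simp only [η]
    module
  have hη : Continuous η := by fun_prop
  have hdiff : ∀ s s', ∑ ζ ∈ boxSites x L, |glue S (η s) t ζ - glue S (η s') t ζ|
      ≤ (boxSites x L).card * α * |s - s'| := by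
    intro s s'
    rw [mul_assoc, ← nsmul_eq_mul]
    refine Finset.sum_le_card_nsmul _ _ _ fun ζ hζ => ?_
    by_cases h : ζ ∈ S
    · simp only [glue, h, dite_true, sub_self, abs_zero]; positivity
    · have e : glue S (η s) t ζ - glue S (η s') t ζ = (ω' ζ - ω ζ) * (s - s') := by
        simp only [glue, h, dite_false, η, Pi.add_apply, Pi.smul_apply, Pi.sub_apply, smul_eq_mul]
        ring
      rw [e, abs_mul]
      gcongr
      exact hωα ζ (Finset.mem_sdiff.2 ⟨hζ, h⟩)
  have key := abs_eigenvalue_sub_le (measurableSet_box x L) (volume_box_ne_top x L)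
    (V := fun s => potential u x L (glue S (η s) t)) (E := fun τ s => E τ (η s, t))
    (κ := (boxSites x L).card * α * up) ⟨fun τ => ?_, fun s hs => hE.2 (η s, t) ⟨hηQ s hs, ht⟩⟩
    (fun s => (hu.aestronglyMeasurable_potential x L _).restrict) (fun s => ?_) (by positivity)
    (fun s s' => ?_) τ
  · simpa [η] using key
  · refine (hE.1 τ).comp (Continuous.continuousOn (by fun_prop)) fun s hs => ⟨hηQ s hs, ht⟩
  · refine ⟨(∑ ζ ∈ boxSites x L, |glue S (η s) t ζ - 0|) * up, ae_restrict_of_ae ?_⟩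
    filter_upwards [hu.ae_abs_potential_sub_le x L (glue S (η s) t) 0] with y hy
    simpa [potential] using hy
  · refine ae_restrict_of_ae ?_
    filter_upwards [hu.ae_abs_potential_sub_le x L (glue S (η s) t) (glue S (η s') t)] with y hy
    refine hy.trans ?_
    rw [mul_right_comm]
    gcongr
    exact hdiff s s'

end Box

/-! ## The scales and the choice of the resolution -/

namespace CantorParams
variable (p : CantorParams)

lemma one_lt_scale (k : ℕ) : 1 < scale p.β p.L₁ k :=
  Real.one_lt_rpow p.one_lt_L₁ (Real.rpow_pos_of_pos (one_pos.trans p.one_lt_β) _)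

lemma scale_succ (k : ℕ) : scale p.β p.L₁ (k + 1) = scale p.β p.L₁ k ^ p.β := by
  have hβ : 0 < p.β := one_pos.trans p.one_lt_β
  rw [scale, scale, ← Real.rpow_mul (one_pos.trans p.one_lt_L₁).le]
  congr 1
  rw [← Real.rpow_add_one hβ.ne']
  congr 1
  push_cast
  ring

lemma scale_mono : Monotone fun k => scale p.β p.L₁ k := by
  refine monotone_nat_of_le_succ fun k => ?_
  rw [p.scale_succ]
  exact Real.self_le_rpow_of_one_le (p.one_lt_scale k).le p.one_lt_β.le

lemma tendsto_scale : Tendsto (fun k => scale p.β p.L₁ k) atTop atTop := by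
  have h1 : Tendsto (fun k : ℕ => p.β ^ ((k : ℝ) - 1)) atTop atTop := by
    have h0 : Tendsto (fun k : ℕ => (k : ℝ) - 1) atTop atTop :=
      tendsto_atTop_add_const_right _ _ tendsto_natCast_atTop_atTop
    exact (tendsto_rpow_atTop_of_base_gt_one _ p.one_lt_β).comp h0
  exact (tendsto_rpow_atTop_of_base_gt_one _ p.one_lt_L₁).comp h1

lemma len_succ_eq (k : ℕ) : len p.β p.L₁ (k + 1) = Real.exp (-scale p.β p.L₁ (k + 1)) := by
  simp [len]

/-- Generation `0` is exceptional: its length is `1` and not `e^(-L_0)`, so only an inequality holds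
uniformly. -/
lemma exp_neg_scale_le_len (k : ℕ) : Real.exp (-scale p.β p.L₁ k) ≤ len p.β p.L₁ k := by
  unfold len
  split_ifs with h
  · rw [Real.exp_le_one_iff]
    linarith [p.one_lt_scale k]
  · exact le_rfl

lemma len_anti : Antitone fun k => len p.β p.L₁ k :=
  antitone_nat_of_succ_le fun k => (sub_pos.1 (p.gap_pos k)).le

lemma tendsto_len : Tendsto (fun k => len p.β p.L₁ k) atTop (𝓝 0) := by
  rw [← tendsto_add_atTop_iff_nat 1]
  simp only [p.len_succ_eq]
  exact Real.tendsto_exp_neg_atTop_nhds_zero.comp ((tendsto_add_atTop_iff_nat 1).2 p.tendsto_scale)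

/-- As `L_{k+1} = L_k · L_k^(β-1)` with `β > 1`, eventually `L_{k+1} ≥ 2 L_k`, while `L_k ≥ log 4`.
The middle gap `α_k - 2 α_{k+1}` is then at least `α_k / 2`. -/
lemma eventually_four_mul_len_succ_le : ∀ᶠ k in atTop, 4 * len p.β p.L₁ (k + 1) ≤ len p.β p.L₁ k := by
  have hβ : 0 < p.β - 1 := sub_pos.2 p.one_lt_β
  filter_upwards [p.tendsto_scale.eventually_ge_atTop (Real.log 4),
    ((tendsto_rpow_atTop hβ).comp p.tendsto_scale).eventually_ge_atTop 2] with k h1 h2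
  refine le_trans ?_ (p.exp_neg_scale_le_len k)
  rw [p.len_succ_eq]
  have h3 : 2 * scale p.β p.L₁ k ≤ scale p.β p.L₁ (k + 1) := by
    have hs := one_pos.trans (p.one_lt_scale k)
    have e := Real.rpow_add_one hs.ne' (p.β - 1)
    rw [sub_add_cancel] at e
    rw [p.scale_succ, e]
    exact mul_le_mul_of_nonneg_right (by simpa using h2) hs.le
  calc 4 * Real.exp (-scale p.β p.L₁ (k + 1))
      = Real.exp (Real.log 4 + -scale p.β p.L₁ (k + 1)) := by
        rw [Real.exp_add, Real.exp_log (by norm_num)]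
    _ ≤ _ := Real.exp_le_exp.2 (by linarith)

/-- In the generations with a large number, the gaps between the intervals are at least half of
the length of the intervals of the preceding generation. -/
lemma eventually_left_add_len_add_le : ∀ᶠ k in atTop, ∀ n n' : ℕ, n < n' → n' < 2 ^ (k + 1) →
    p.left (k + 1) n + len p.β p.L₁ (k + 1) + len p.β p.L₁ k / 2 ≤ p.left (k + 1) n' := by
  -- The finitely many early generations have gaps of at least a fixed `c > 0`, which exceeds `α_k`
  -- for large `k`.
  obtain ⟨i₀, hi₀⟩ := eventually_atTop.1 p.eventually_four_mul_len_succ_le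
  obtain ⟨c, hc0, hc⟩ := p.exists_pos_le_gap i₀
  filter_upwards [p.tendsto_len.eventually_lt_const hc0] with k hk n n' hn hn'
  refine p.left_add_len_add_le (fun i hi => ?_) hn hn'
  rcases lt_or_ge i i₀ with h | h
  · have := p.len_pos k
    linarith [hc i h]
  · have h1 := hi₀ i h
    have h2 : len p.β p.L₁ k ≤ len p.β p.L₁ i := p.len_anti (Nat.lt_succ_iff.1 hi)
    linarith

end CantorParams

lemma eventually_add_le_rpow {q γ : ℝ} (hq : q < γ) (hγ : 0 < γ) (a b b' : ℝ) {c : ℝ} (hc : 0 < c) :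
    ∀ᶠ l : ℝ in atTop, a + b * Real.log l + b' * (l ^ q * Real.log l) ≤ c * l ^ γ := by
  have h1 : (fun _ : ℝ => a) =o[atTop] fun l : ℝ => l ^ γ :=
    Asymptotics.isLittleO_const_left.2 (Or.inr (tendsto_norm_atTop_atTop.comp (tendsto_rpow_atTop hγ)))
  have h2 : (fun l : ℝ => b * Real.log l) =o[atTop] fun l : ℝ => l ^ γ :=
    (isLittleO_log_rpow_atTop hγ).const_mul_left b
  have h3 : (fun l : ℝ => b' * (l ^ q * Real.log l)) =o[atTop] fun l : ℝ => l ^ γ := by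
    refine Asymptotics.IsLittleO.const_mul_left ?_ b'
    have h4 : (fun l : ℝ => l ^ q * Real.log l) =o[atTop] fun l : ℝ => l ^ q * l ^ (γ - q) :=
      (Asymptotics.isBigO_refl _ _).mul_isLittleO (isLittleO_log_rpow_atTop (sub_pos.2 hq))
    refine h4.congr' .rfl ?_
    filter_upwards [eventually_gt_atTop 0] with l hl
    rw [← Real.rpow_add hl]
    congr 1
    ring
  filter_upwards [((h1.add h2).add h3).bound hc, eventually_ge_atTop 0] with l hl hl0
  refine (le_abs_self _).trans ?_
  rw [Real.norm_eq_abs, Real.norm_of_nonneg (Real.rpow_nonneg hl0 _)] at hl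
  exact hl

lemma rpow_add_three_pow_le {β l : ℝ} (hβ : 0 ≤ β) (hl : 1 ≤ l) (d : ℕ) :
    (l ^ β + 3) ^ d ≤ Real.exp (d * Real.log 4 + d * β * Real.log l) := by
  have h1 : 1 ≤ l ^ β := Real.one_le_rpow hl hβ
  have hl0 : 0 < l := by linarith
  have h2 : Real.exp (d * Real.log 4 + d * β * Real.log l) = (4 * l ^ β) ^ d := by
    rw [show (d : ℝ) * Real.log 4 + d * β * Real.log l = d * (Real.log 4 + Real.log l * β) by ring,
      Real.exp_nat_mul, Real.exp_add, Real.exp_log (by norm_num), Real.rpow_def_of_pos hl0]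
  rw [h2]
  gcongr
  linarith

/-- The estimates which hold on all large scales `l`. -/
structure LargeScale (d : ℕ) (β ε c₁ c₂ c₃ up l : ℝ) : Prop where
  one_le : 1 ≤ l
  -- In the notation `m`, `M`, `N` of `exists_resolution`, this gives `N α_k u₊ + N α_k ≤ m²`;
  -- `slope` serves generation `k - 1`; `half` says `16 m ≤ √m` and serves to exclude that
  -- generation when `L_{k-1}` is small.
  small_interval : (l ^ β + 3) ^ d * (up + 1) * Real.exp (-l ^ (β * (1 - ε)))
    ≤ Real.exp (-(c₃ * (l ^ (4 / 3 : ℝ) * Real.log l))) ^ 2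
  window : 8 * Real.exp (-(c₃ * (l ^ (4 / 3 : ℝ) * Real.log l))) ≤ Real.exp (-c₁ * l)
  slope : 8 * Real.exp (-(c₃ * (l ^ (4 / 3 : ℝ) * Real.log l)))
    + 64 * ((l ^ β + 3) ^ d * Real.exp (-c₂ * l)) < Real.exp (-l ^ (1 - ε))
  half : 16 * Real.exp (-(c₃ * (l ^ (4 / 3 : ℝ) * Real.log l)))
    ≤ Real.exp (-(c₃ * (l ^ (4 / 3 : ℝ) * Real.log l)) / 2)

/-- After taking logarithms, only powers of `l` compete: `β(1 - ε) > 4/3` for `small_interval`, `4/3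
> 1` for `window`, and `4/3 > 1 - ε` with `1 > 1 - ε` for `slope`. The bound `l ≥ e` gives `log l ≥
1`. -/
lemma eventually_largeScale (d : ℕ) {β ε c₁ c₂ c₃ up : ℝ} (hβ1 : 0 < β) (hε : 0 < ε)
    (hβ : 4 / 3 < β * (1 - ε)) (hc₂ : 0 < c₂) (hc₃ : 0 < c₃) (hup : 0 < up) :
    ∀ᶠ l in atTop, LargeScale d β ε c₁ c₂ c₃ up l := by
  have hε1 : 0 < 1 - ε := by
    by_contra! h
    nlinarith
  filter_upwards [eventually_ge_atTop (Real.exp 1),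
    eventually_add_le_rpow hβ (by linarith) (d * Real.log 4 + Real.log (up + 1)) (d * β) (2 * c₃)
      one_pos,
    eventually_add_le_rpow (show (1 : ℝ) < 4 / 3 by norm_num) (by norm_num) (Real.log 8) 0 |c₁| hc₃,
    eventually_add_le_rpow (show 1 - ε < 4 / 3 by linarith) (by norm_num) (Real.log 32) 0 1 hc₃,
    eventually_add_le_rpow (show 1 - ε < 1 by linarith) one_pos (Real.log 256 + d * Real.log 4)
      (d * β) 1 hc₂,
    eventually_add_le_rpow (show (0 : ℝ) < 4 / 3 by norm_num) (by norm_num) (Real.log 16) 0 0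
      (half_pos hc₃)] with l he h1 h2 h3 h4 h5
  have hl1 : 1 ≤ l := le_trans (by linarith [Real.add_one_le_exp 1]) he
  have hl0 : 0 < l := by linarith
  have hlog : 1 ≤ Real.log l := (Real.le_log_iff_exp_le hl0).2 he
  have hP := rpow_add_three_pow_le hβ1.le hl1 d
  have hX : c₃ * l ^ (4 / 3 : ℝ) ≤ c₃ * (l ^ (4 / 3 : ℝ) * Real.log l) :=
    mul_le_mul_of_nonneg_left (le_mul_of_one_le_right (Real.rpow_nonneg hl0.le _) hlog) hc₃.le
  have hE : l ^ (1 - ε) ≤ l ^ (1 - ε) * Real.log l :=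
    le_mul_of_one_le_right (Real.rpow_nonneg hl0.le _) hlog
  rw [Real.rpow_one] at h2 h4
  have hexp : ∀ {a x y : ℝ}, 0 < a → Real.log a + x ≤ y → a * Real.exp x ≤ Real.exp y := by
    intro a x y ha h
    rw [← Real.exp_log ha, ← Real.exp_add]
    exact Real.exp_le_exp.2 h
  refine ⟨hl1, ?_, ?_, ?_, ?_⟩
  · calc (l ^ β + 3) ^ d * (up + 1) * Real.exp (-l ^ (β * (1 - ε)))
        ≤ Real.exp (d * Real.log 4 + d * β * Real.log l) * Real.exp (Real.log (up + 1)) *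
          Real.exp (-l ^ (β * (1 - ε))) := by
          rw [Real.exp_log (by linarith : 0 < up + 1)]; gcongr
      _ = Real.exp (d * Real.log 4 + d * β * Real.log l + Real.log (up + 1)
            + -l ^ (β * (1 - ε))) := by
          rw [Real.exp_add _ (-l ^ (β * (1 - ε))), Real.exp_add _ (Real.log (up + 1))]
      _ ≤ Real.exp ((2 : ℕ) * -(c₃ * (l ^ (4 / 3 : ℝ) * Real.log l))) := by
          refine Real.exp_le_exp.2 ?_
          push_cast
          linarith
      _ = _ := Real.exp_nat_mul _ 2
  · refine hexp (by norm_num) ?_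
    have h6 : c₁ * l ≤ |c₁| * (l * Real.log l) :=
      (mul_le_mul_of_nonneg_right (le_abs_self c₁) hl0.le).trans
        (mul_le_mul_of_nonneg_left (le_mul_of_one_le_right hl0.le hlog) (abs_nonneg _))
    linarith
  · have a1 : 32 * Real.exp (-(c₃ * (l ^ (4 / 3 : ℝ) * Real.log l))) ≤ Real.exp (-l ^ (1 - ε)) :=
      hexp (by norm_num) (by linarith)
    have a2 : 256 * ((l ^ β + 3) ^ d * Real.exp (-c₂ * l)) ≤ Real.exp (-l ^ (1 - ε)) := by
      calc 256 * ((l ^ β + 3) ^ d * Real.exp (-c₂ * l))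
          ≤ 256 * (Real.exp (d * Real.log 4 + d * β * Real.log l) * Real.exp (-c₂ * l)) := by gcongr
        _ = 256 * Real.exp (d * Real.log 4 + d * β * Real.log l + -c₂ * l) := by rw [← Real.exp_add]
        _ ≤ _ := hexp (by norm_num) (by linarith)
    linarith [Real.exp_pos (-l ^ (1 - ε))]
  · exact hexp (by norm_num) (by linarith)

/-- The choice of the resolution `j`. -/
lemma exists_resolution (d : ℕ) (p : CantorParams) {ε c₁ c₂ c₃ up : ℝ} (hε : 0 < ε) (hε1 : ε < 1)
    (hβ : 4 / 3 < p.β * (1 - ε)) (hc₂ : 0 < c₂) (hc₃ : 0 < c₃) (hup : 0 < up) :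
    ∃ Lmin : ℝ, ∀ L, Lmin ≤ L → ∀ k, IsResolution p ε L k → ∀ l, l = L ^ (1 / p.β) →
      0 < l ∧ 0 < L ∧ ∃ j : ℕ, (j + 1 = k ∨ j + 2 = k) ∧
      (scale p.β p.L₁ (k - 1) ≤ c₃ / 2 * l ^ (4 / 3 : ℝ) * Real.log l → j + 1 = k) ∧
      (∀ n n' : ℕ, n < n' → n' < 2 ^ (j + 1) →
        p.left (j + 1) n + len p.β p.L₁ (j + 1) + len p.β p.L₁ j / 2 ≤ p.left (j + 1) n') ∧
      2 * (Real.exp (-2 * c₃ * l ^ (4 / 3 : ℝ) * Real.log l) + (L + 3) ^ d * len p.β p.L₁ k * up)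
        + 2 * Real.exp (-c₂ * l) * len p.β p.L₁ (j + 1) * (L + 3) ^ d
        < Real.exp (-c₃ * l ^ (4 / 3 : ℝ) * Real.log l) * (len p.β p.L₁ j / 2) ∧
      2 * (Real.exp (-2 * c₃ * l ^ (4 / 3 : ℝ) * Real.log l) + (L + 3) ^ d * len p.β p.L₁ k * up)
        + 2 * Real.exp (-c₂ * l) * len p.β p.L₁ (j + 1) * (L + 3) ^ d < Real.exp (-c₁ * l) := by
  have hβ0 : 0 < p.β := one_pos.trans p.one_lt_β
  have hε1' : 0 < 1 - ε := sub_pos.2 hε1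
  obtain ⟨l₀, hl₀⟩ := eventually_atTop.1
    (eventually_largeScale d (c₁ := c₁) hβ0 hε hβ hc₂ hc₃ hup)
  obtain ⟨k₀, hk₀⟩ := eventually_atTop.1 p.eventually_left_add_len_add_le
  obtain ⟨La, hLa⟩ := eventually_atTop.1
    ((tendsto_rpow_atTop (one_div_pos.2 hβ0)).eventually_ge_atTop l₀)
  refine ⟨max (max La 1) (scale p.β p.L₁ (k₀ + 2) ^ (1 / (1 - ε)) + 1), ?_⟩
  intro L hL k hk l hl
  have hL1 : 1 ≤ L := (le_max_right _ _).trans ((le_max_left _ _).trans hL)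
  have hL0 : 0 < L := by linarith
  have hLS := hl₀ l (hl ▸ hLa L ((le_max_left _ _).trans ((le_max_left _ _).trans hL)))
  have hl0 : 0 < l := by linarith [hLS.one_le]
  have hlL : l ^ p.β = L := by
    rw [hl, ← Real.rpow_mul hL0.le, one_div, inv_mul_cancel₀ hβ0.ne', Real.rpow_one]
  obtain ⟨-, hk1, hk2⟩ := hk
  have hkk : k₀ + 2 < k := by
    by_contra! h
    have h1 : scale p.β p.L₁ k ^ (1 / (1 - ε)) ≤ scale p.β p.L₁ (k₀ + 2) ^ (1 / (1 - ε)) :=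
      Real.rpow_le_rpow (one_pos.trans (p.one_lt_scale k)).le (p.scale_mono h)
        (one_div_nonneg.2 hε1'.le)
    have h2 := (le_max_right _ _).trans hL
    linarith
  obtain ⟨i, rfl⟩ : ∃ i, k = i + 2 := ⟨k - 2, by omega⟩
  rw [show i + 2 - 1 = i + 1 by omega] at hk1 ⊢
  have hs : ∀ n, 0 < scale p.β p.L₁ n := fun n => one_pos.trans (p.one_lt_scale n)
  have hscale_k : l ^ (p.β * (1 - ε)) ≤ scale p.β p.L₁ (i + 2) := by
    rw [Real.rpow_mul hl0.le, hlL]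
    calc L ^ (1 - ε) ≤ (scale p.β p.L₁ (i + 2) ^ (1 / (1 - ε))) ^ (1 - ε) := by gcongr
      _ = _ := by
        rw [← Real.rpow_mul (hs _).le, one_div, inv_mul_cancel₀ hε1'.ne', Real.rpow_one]
  -- `L_{k-2}` is `L_{k-1}^(1/β)`, and `L_{k-1} < L^(1-ε)` with `L = ℓ^β`; so `α_{k-2}` is at least
  -- `exp(-ℓ^(1-ε))`, far larger than `m` and `M`.
  have hscale_i : scale p.β p.L₁ i ≤ l ^ (1 - ε) := by
    have h1 : scale p.β p.L₁ (i + 1) ≤ L ^ (1 - ε) := by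
      calc scale p.β p.L₁ (i + 1)
          = (scale p.β p.L₁ (i + 1) ^ (1 / (1 - ε))) ^ (1 - ε) := by
            rw [← Real.rpow_mul (hs _).le, one_div, inv_mul_cancel₀ hε1'.ne', Real.rpow_one]
        _ ≤ L ^ (1 - ε) := by
            gcongr
            exact Real.rpow_nonneg (hs _).le _
    calc scale p.β p.L₁ i = scale p.β p.L₁ (i + 1) ^ (1 / p.β) := by
          rw [p.scale_succ, ← Real.rpow_mul (hs _).le, mul_one_div_cancel hβ0.ne', Real.rpow_one]
      _ ≤ (L ^ (1 - ε)) ^ (1 / p.β) := by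
          gcongr
          exact (hs _).le
      _ = l ^ (1 - ε) := by
          rw [hl, ← Real.rpow_mul hL0.le, ← Real.rpow_mul hL0.le, mul_comm]
  set m := Real.exp (-(c₃ * (l ^ (4 / 3 : ℝ) * Real.log l))) with hm
  have em : Real.exp (-c₃ * l ^ (4 / 3 : ℝ) * Real.log l) = m := by rw [hm]; congr 1; ring
  have em2 : Real.exp (-2 * c₃ * l ^ (4 / 3 : ℝ) * Real.log l) = m ^ 2 := by
    rw [hm, ← Real.exp_nat_mul]; congr 1; push_cast; ring
  rw [em, em2]
  have hm0 : 0 < m := Real.exp_pos _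
  set M := Real.exp (-c₂ * l) with hM
  have hM0 : 0 < M := Real.exp_pos _
  have hM1 : M ≤ 1 := Real.exp_le_one_iff.2 (by nlinarith)
  set N := (L + 3) ^ d with hN
  have hN0 : 0 ≤ N := by positivity
  obtain ⟨-, A1, A2, A3, A0⟩ := hLS
  rw [hlL] at A1 A3
  rw [← hN] at A1 A3
  rw [← hm] at A1 A2 A3 A0
  rw [← hM] at A3
  have hαk : len p.β p.L₁ (i + 2) ≤ Real.exp (-l ^ (p.β * (1 - ε))) := by
    rw [p.len_succ_eq]
    exact Real.exp_le_exp.2 (neg_le_neg hscale_k)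
  have hαk0 := p.len_pos (i + 2)
  have hα0 := p.len_pos (i + 1)
  have B1 : N * len p.β p.L₁ (i + 2) * up + N * len p.β p.L₁ (i + 2) ≤ m ^ 2 := by
    calc _ = N * (up + 1) * len p.β p.L₁ (i + 2) := by ring
      _ ≤ N * (up + 1) * Real.exp (-l ^ (p.β * (1 - ε))) := by gcongr
      _ ≤ m ^ 2 := A1
  have hNα : 0 ≤ N * len p.β p.L₁ (i + 2) := by positivity
  have hNαu : 0 ≤ N * len p.β p.L₁ (i + 2) * up := by positivity
  have hαi : Real.exp (-l ^ (1 - ε)) ≤ len p.β p.L₁ i :=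
    (Real.exp_le_exp.2 (neg_le_neg hscale_i)).trans (p.exp_neg_scale_le_len i)
  have hexp1 : Real.exp (-l ^ (1 - ε)) ≤ 1 :=
    Real.exp_le_one_iff.2 (neg_nonpos.2 (Real.rpow_nonneg hl0.le _))
  have hMN0 : 0 ≤ N * M := by positivity
  have hm8 : 8 * m < 1 := by linarith
  have hm2 : 0 < m ^ 2 := by positivity
  have hm2' : m ^ 2 ≤ m / 8 := by nlinarith
  refine ⟨hl0, hL0, ?_⟩
  have hlen := p.len_succ_eq i
  clear_value m M N
  -- In both cases `w + κ ≤ 2m²`. If `α_{k-1} ≥ 16m`, then generation `k` has `mγ ≥ 8m²`, against a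
  -- total of at most `4m²`. Otherwise, in generation `k - 1`, the total is at most `m (4m + 32MN)`,
  -- which `slope` puts below `m α_{k-2} / 2`.
  rcases le_or_gt (16 * m) (len p.β p.L₁ (i + 1)) with hcase | hcase
  · have B2 := mul_le_mul_of_nonneg_left hM1 hNα
    have B4 : m * (8 * m) ≤ m * (len p.β p.L₁ (i + 1) / 2) :=
      mul_le_mul_of_nonneg_left (by linarith) hm0.le
    exact ⟨i + 1, Or.inl rfl, fun _ => rfl, hk₀ (i + 1) (by omega), by linarith, by linarith⟩
  · have B2 := mul_le_mul_of_nonneg_left hcase.le hMN0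
    have B4 : m * ((8 * m + 64 * (N * M)) / 2) < m * (len p.β p.L₁ i / 2) :=
      mul_lt_mul_of_pos_left (by linarith) hm0
    have B5 : m * (N * M) ≤ m * (1 / 64) := mul_le_mul_of_nonneg_left (by linarith) hm0.le
    refine ⟨i, Or.inr rfl, fun h => ?_, hk₀ i (by omega), by linarith, by linarith⟩
    -- If `L_{k-1} ≤ (c₃/2) ℓ^(4/3) log ℓ`, then `α_{k-1} ≥ √m ≥ 16m`, so the second case does not
    -- occur.
    refine absurd hcase (not_lt.2 (A0.trans ?_))
    rw [hlen]
    exact Real.exp_le_exp.2 (by linarith)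

/-! ## The antichain of the classes where the eigenvalue is close to the given energy -/

lemma inClass_unique {d : ℕ} (p : CantorParams) {j : ℕ} {S : Finset (Zd d)} {a a' : Classes j S}
    {ω : Zd d → ℝ} (h : InClass p a ω) (h' : InClass p a' ω) : a = a' :=
  funext fun i => Fin.ext (p.interval_index_unique (a i).2 (a' i).2 (h i) (h' i))

lemma exists_inClass {d : ℕ} {p : CantorParams} {ω : Zd d → ℝ} (hω : ω ∈ Omega p d) (j : ℕ)
    (S : Finset (Zd d)) : ∃ a : Classes j S, InClass p a ω := by
  choose a ha using fun i : S => p.exists_mem_interval (hω i) j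
  exact ⟨a, ha⟩

/-- Every class is contained in a class of the preceding generation. -/
lemma exists_parent {d : ℕ} (p : CantorParams) (j : ℕ) (S : Finset (Zd d)) :
    ∃ π : Classes (j + 1) S → Classes j S, ∀ s ω, InClass p s ω → InClass p (π s) ω := by
  refine ⟨fun s i => ⟨(s i : ℕ) / 2, ?_⟩, fun s ω h i => p.interval_succ_subset _ _ (h i)⟩
  have h := (s i).2
  have h2 : 2 ^ (j + 1) = 2 * 2 ^ j := pow_succ' 2 j
  omega

lemma restr_mem_Icc {d : ℕ} {p : CantorParams} {ω : Zd d → ℝ} (hω : ω ∈ Omega p d)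
    (S : Finset (Zd d)) : restr S ω ∈ Icc (0 : S → ℝ) 1 :=
  ⟨fun i => (p.cantor_subset_Icc (hω i)).1, fun i => (p.cantor_subset_Icc (hω i)).2⟩

/-- The classes which contain a point where `F` is within `w` of `E₀`. -/
def touchedClasses {d : ℕ} (p : CantorParams) (j : ℕ) (S : Finset (Zd d)) (F : (S → ℝ) → ℝ)
    (E₀ w : ℝ) : Set (Classes j S) :=
  {a | ∃ t ∈ Icc (0 : S → ℝ) 1, (∀ i, t i ∈ p.interval j (a i)) ∧ |F t - E₀| < w}

/-- For touched classes `a < a'`, a coordinate with `a i < a' i` rises by at least `γ`, and one with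
equal intervals falls by at most their length. Hence `F`, starting above `E₀ - w` in `a`, is at
least `E₀ + w` at the touching point of `a'`, a contradiction. -/
lemma isAntichain_touchedClasses {d : ℕ} (p : CantorParams) {j : ℕ} {S : Finset (Zd d)}
    {F : (S → ℝ) → ℝ} {E₀ w r m M γ N : ℝ} (hF : ContinuousOn F (Icc 0 1))
    (hd : ∀ t ∈ Icc (0 : S → ℝ) 1, |F t - E₀| < r → ∀ i, ∃ D,
      HasDerivWithinAt (fun q => F (Function.update t i q)) D (Icc 0 1) (t i) ∧ m ≤ D ∧ D ≤ M)
    (hm : 0 < m) (hM : 0 < M) (hγ : 0 < γ) (hw : 0 < w) (hN : (S.card : ℝ) ≤ N)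
    (hgap : ∀ n n' : ℕ, n < n' → n' < 2 ^ j →
      p.left j n + len p.β p.L₁ j + γ ≤ p.left j n')
    (h1 : 2 * w + 2 * M * len p.β p.L₁ j * N < m * γ)
    (h2 : 2 * w + 2 * M * len p.β p.L₁ j * N < r) :
    IsAntichain (· ≤ ·) (touchedClasses p j S F E₀ w) := by
  rintro a ⟨t, ht, hta, hFt⟩ a' ⟨t', ht', hta', hFt'⟩ hne hle
  have hlen := p.len_pos j
  obtain ⟨i₀, hi₀⟩ : ∃ i, a i < a' i := by
    by_contra! h
    exact hne (le_antisymm hle h)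
  have hup : ∀ i, a i < a' i → γ ≤ t' i - t i := fun i hi => by
    have := hgap _ _ (Fin.lt_def.1 hi) (a' i).2
    linarith [(hta i).2, (hta' i).1]
  have hN' : 2 * M * len p.β p.L₁ j * S.card ≤ 2 * M * len p.β p.L₁ j * N := by gcongr
  have hN0 : 0 ≤ 2 * M * len p.β p.L₁ j * S.card := by positivity
  rw [abs_lt] at hFt hFt'
  have key := le_of_partialDeriv_mem_Icc (A := E₀ - r) (B := E₀ + r) (c := E₀ - w) (v := E₀ + w)
    hF (fun t ht hA hB => hd t ht (abs_lt.2 ⟨by linarith, by linarith⟩)) hm hM hlen hγ ht ht' i₀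
    (hup i₀ hi₀) (fun i => ?_) (by linarith) (by linarith) (by linarith)
    (by rw [Fintype.card_coe]; linarith) (by rw [Fintype.card_coe]; linarith)
  · linarith
  · rcases (hle i).lt_or_eq with h | h
    · linarith [hup i h]
    · have := hta' i
      rw [← h] at this
      exact (le_abs_self _).trans (p.abs_sub_le_len (hta i) this)

open Classical in
/-- The part of a basic event outside the union of the subevents whose class does not lie in a
class of a given set is the union of the subevents of this set. -/
lemma bevent_sdiff_iUnion_eq {d : ℕ} {p : CantorParams} {k j : ℕ} {B S : Finset (Zd d)}
    (b : Classes k B) {π : Classes k S → Classes j S}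
    (hπ : ∀ s ω, InClass p s ω → InClass p (π s) ω) (A : Finset (Classes j S)) :
    bevent p b \ (⋃ s ∈ Finset.univ.filter fun s => π s ∉ A, subevent p b s)
      = ⋃ a ∈ A, subevent p b a := by
  ext ω
  simp only [Set.mem_sdiff, mem_iUnion, Finset.mem_filter, Finset.mem_univ, true_and, exists_prop,
    not_exists, not_and]
  constructor
  · rintro ⟨hω, h⟩
    obtain ⟨s, hs⟩ := exists_inClass hω.1 k S
    refine ⟨π s, ?_, hω, hπ s ω hs⟩
    by_contra hns
    exact h s hns ⟨hω, hs⟩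
  · rintro ⟨a, ha, hω, haω⟩
    refine ⟨hω, fun s hs hsω => hs ?_⟩
    rw [inClass_unique p (hπ s ω hsω.2) haω]
    exact ha

end CantorAnderson

end

/-! ### The lemma -/

open CantorAnderson
theorem mainTheorem3 (d : ℕ) (hd : 1 ≤ d) (p : CantorParams)
    (u : Sp d → ℝ) (um up δm δp : ℝ) (hu : IsSingleSite u um up δm δp)
    (ε : ℝ) (hε : 0 < ε) (hε1 : ε < 1) (hβ : 4 / 3 < p.β * (1 - ε))
    (δ : ℝ) (hδ : 0 < δ) (hδd : δ < d)
    (c₁ c₂ c₃ : ℝ) (hc₁ : 0 < c₁) (hc₂ : 0 < c₂) (hc₃ : 0 < c₃) :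
    ∃ C Lmin : ℝ, 0 < C ∧ ∀ (L : ℝ), Lmin ≤ L → ∀ (k : ℕ), IsResolution p ε L k →
      ∀ (ℓ : ℝ), ℓ = L ^ (1 / p.β) →
      -- the box `Λ`, the free sites `S`, the class `[B]` and the configuration `ω`
      ∀ (x : Sp d) (S : Finset (Zd d)), S ⊆ boxSites x (L - δp) →
      ℓ ^ ((d : ℝ) - δ) ≤ (S.card : ℝ) →
      ∀ (b : Classes k (boxSites x L \ S)) (ω : Zd d → ℝ), ω ∈ bevent p b →
      -- background configurations with values in the intervals of `[B]`
      ∀ (Q : Set (Zd d → ℝ)), Convex ℝ Q → (∀ η ∈ Q, InClass p b η) → ω ∈ Q →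
      -- the eigenvalues `E_τ(η, t_S)` of `H_{η, t_S, Λ}`, and one of them
      ∀ (E₀ : ℝ) (E : ℕ → (Zd d → ℝ) × (S → ℝ) → ℝ),
      IsEigenvalueParametrization (box x L) (Q ×ˢ Icc 0 1)
        (fun z => potential u x L (glue S z.1 z.2)) E →
      ∀ (τ₀ : ℕ),
      |E τ₀ (ω, 0) - E₀| < Real.exp (-c₁ * ℓ) →
      (∀ t ∈ Icc (0 : S → ℝ) 1, |E τ₀ (ω, t) - E₀| < Real.exp (-c₁ * ℓ) → ∀ i : S, ∃ D : ℝ,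
        HasDerivWithinAt (fun r => E τ₀ (ω, Function.update t i r)) D (Icc 0 1) (t i) ∧
        Real.exp (-c₃ * ℓ ^ (4 / 3 : ℝ) * Real.log ℓ) ≤ D ∧ D ≤ Real.exp (-c₂ * ℓ)) →
      -- `Ω_[B]` is the disjoint union of the `([B], [S])` with `[S] ∈ 𝒢`
      ∃ (𝒢 : Finset (Classes k S)) (ΩB : Set (Zd d → ℝ)),
        (𝒢 : Set (Classes k S)).PairwiseDisjoint (fun s => subevent p b s) ∧
        ΩB = ⋃ s ∈ 𝒢, subevent p b s ∧
        ΩB ⊆ bevent p b ∧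
        {ω' ∈ bevent p b |
            |E τ₀ (ω, restr S ω') - E₀| < Real.exp (-2 * c₃ * ℓ ^ (4 / 3 : ℝ) * Real.log ℓ)}
          ⊆ bevent p b \ ΩB ∧
        {ω' ∈ bevent p b | ω' ∈ Q ∧
            |E τ₀ (ω', restr S ω') - E₀| < Real.exp (-2 * c₃ * ℓ ^ (4 / 3 : ℝ) * Real.log ℓ)}
          ⊆ bevent p b \ ΩB ∧
        (∃ (j : ℕ) (𝒜 : Finset (Classes j S)),
          (j = k ∨ j + 1 = k) ∧
          (scale p.β p.L₁ (k - 1) ≤ c₃ / 2 * ℓ ^ (4 / 3 : ℝ) * Real.log ℓ → j = k) ∧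
          IsAntichain (· ≤ ·) (𝒜 : Set (Classes j S)) ∧
          bevent p b \ ΩB = ⋃ a ∈ 𝒜, subevent p b a) ∧
        (cond (law p d) (bevent p b)).real (bevent p b \ ΩB) ≤ C * ℓ ^ (-((d : ℝ) - δ) / 2) := by

  classical
  obtain ⟨Lmin, hLmin⟩ := exists_resolution d p (c₁ := c₁) hε hε1 hβ hc₂ hc₃ hu.2.1
  refine ⟨1, Lmin, one_pos, ?_⟩
  intro L hL k hk ℓ hℓ x S hSbox hScard b ω hω Q hQ hQb hωQ E₀ E hE τ₀ _ hder
  obtain ⟨hℓ0, hL0, j, hjk, hjk', hgap, h1, h2⟩ := hLmin L hL k hk ℓ hℓ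
  set w := Real.exp (-2 * c₃ * ℓ ^ (4 / 3 : ℝ) * Real.log ℓ)
  -- This bounds the displacement of the eigenvalue when the background varies in the intervals of
  -- `[B]`, of length `α_k`.
  set κ := (L + 3) ^ d * len p.β p.L₁ k * up with hκ
  have hup : 0 < up := hu.2.1
  have hδp : 0 < δp := hu.2.2.2.1
  have hk0 := p.len_pos k
  have hκ0 : 0 < κ := by positivity
  have hw0 : 0 < w := Real.exp_pos _
  have hSsub : S ⊆ boxSites x L := fun ζ hζ => by
    have h := mem_boxSites.1 (hSbox hζ)
    exact mem_boxSites.2 fun i => (h i).trans (by linarith)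
  have hcard := card_boxSites_le x hL0.le
  have hSN : (S.card : ℝ) ≤ (L + 3) ^ d :=
    le_trans (by exact_mod_cast Finset.card_le_card hSsub) hcard
  have hS0 : 0 < S.card := by
    have : (0 : ℝ) < S.card := (Real.rpow_pos_of_pos hℓ0 _).trans_le hScard
    exact_mod_cast this
  have hF : ContinuousOn (fun t => E τ₀ (ω, t)) (Icc 0 1) :=
    (hE.1 τ₀).comp (Continuous.continuousOn (by fun_prop)) fun t ht => ⟨hωQ, ht⟩
  -- The window is widened by `κ`, so that one antichain, defined with the background `ω` alone,
  -- covers both bad sets.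
  let A : Finset (Classes (j + 1) S) :=
    (touchedClasses p (j + 1) S (fun t => E τ₀ (ω, t)) E₀ (w + κ)).toFinset
  have hAmem : ∀ a, a ∈ A ↔ a ∈ touchedClasses p (j + 1) S (fun t => E τ₀ (ω, t)) E₀ (w + κ) :=
    fun a => Set.mem_toFinset
  have hanti : IsAntichain (· ≤ ·) (A : Set (Classes (j + 1) S)) := by
    simp only [A, Set.coe_toFinset]
    exact isAntichain_touchedClasses p hF hder (Real.exp_pos _) (Real.exp_pos _)
      (half_pos (p.len_pos j)) (by linarith) hSN hgap h1 h2
  -- The antichain lives in generation `j + 1`, which is `k` or `k - 1`, while `Ω_[B]` is made of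
  -- classes of generation `k`; `π` maps these to the classes of generation `j + 1` containing them.
  obtain ⟨π, hπ⟩ : ∃ π : Classes k S → Classes (j + 1) S,
      ∀ s ω, InClass p s ω → InClass p (π s) ω := by
    rcases hjk with rfl | rfl
    · exact ⟨id, fun s ω h => h⟩
    · exact exists_parent p (j + 1) S
  have hsdiff := bevent_sdiff_iUnion_eq b hπ A
  have hcover : ∀ ω' ∈ bevent p b, |E τ₀ (ω, restr S ω') - E₀| < w + κ →
      ω' ∈ ⋃ a ∈ A, subevent p b a := by
    intro ω' hω' h
    obtain ⟨a, ha⟩ := exists_inClass hω'.1 (j + 1) S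
    exact mem_biUnion ((hAmem a).2 ⟨restr S ω', restr_mem_Icc hω'.1 S, ha, h⟩) ⟨hω', ha⟩
  refine ⟨Finset.univ.filter fun s => π s ∉ A, _, ?_, rfl, ?_, ?_, ?_, ⟨j + 1, A, ?_, ?_, hanti, ?_⟩,
    ?_⟩
  · intro s _ s' _ hne
    refine Set.disjoint_left.2 fun ω' h h' => hne ?_
    exact inClass_unique p h.2 h'.2
  · exact iUnion₂_subset fun s _ ω' h => h.1
  · rw [hsdiff]
    rintro ω' ⟨hω', h⟩
    exact hcover ω' hω' (h.trans (by linarith))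
  · rw [hsdiff]
    rintro ω' ⟨hω', hω'Q, h⟩
    refine hcover ω' hω' ?_
    -- The free coordinates are those of `ω'` on both sides, and only the background passes from `ω`
    -- to `ω'`.
    have h3 := abs_eigenvalue_sub_le_of_segment hu hQ hE hωQ hω'Q (restr_mem_Icc hω'.1 S) hk0.le
      (fun ζ hζ => p.abs_sub_le_len (hω'.2 ⟨ζ, hζ⟩) (hω.2 ⟨ζ, hζ⟩)) τ₀
    have h4 : (boxSites x L).card * len p.β p.L₁ k * up ≤ κ := by rw [hκ]; gcongr
    have h5 := abs_sub_le (E τ₀ (ω, restr S ω')) (E τ₀ (ω', restr S ω')) E₀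
    rw [abs_sub_comm (E τ₀ (ω, restr S ω')) (E τ₀ (ω', restr S ω'))] at h5
    linarith
  · omega
  · exact hjk'
  · exact hsdiff
  · rw [hsdiff, one_mul]
    refine (cond_iUnion_antichain_le p (by omega) Finset.sdiff_disjoint hS0 b A hanti).trans ?_
    have h6 : ℓ ^ (-((d : ℝ) - δ) / 2) = (Real.sqrt (ℓ ^ ((d : ℝ) - δ)))⁻¹ := by
      rw [Real.sqrt_eq_rpow, ← Real.rpow_mul hℓ0.le, ← Real.rpow_neg hℓ0.le]
      congr 1
      ring
    rw [h6]
    have h7 : 0 < Real.sqrt (ℓ ^ ((d : ℝ) - δ)) := Real.sqrt_pos.2 (Real.rpow_pos_of_pos hℓ0 _)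
    gcongr
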